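/- Let $M$ be a smooth manifold, $E\to M$ a smooth real vector bundle of finite rank and $\langle\cdot,\cdot\rangle$ a smooth fibrewise non-degenerate symmetric bilinear form on $E$. A *pre-Courant algebroid* with this inner product consists of a smooth bundle map $\rho:E\to TM$ over $\mathrm{id}_M$ (the anchor) and an $\mathbb R$-bilinear operation $\circ$ on $\Gamma(E)$ such that $$\rho(X)\langle Y,Z\rangle=\langle X\circ Y,Z\rangle+\langle Y,X\circ Z\rangle,\qquad \rho(X)\langle Y,Z\rangle=\langle X,Y\circ Z\rangle+\langle X,Z\circ Y\rangle$$ for all $X,Y,Z\in\Gamma(E)$. It is a *Courant algebroid* if moreover $X\circ(Y\circ Z)=(X\circ Y)\circ Z+Y\circ(X\circ Z)$. A function $f\in C^\infty(M)$ is a *Casimir* if $\rho(X)f=0$ for all $X$. Put $V=C^\infty(M)\oplus\Gamma(E)$, with functions in degree $-2$ and sections in degree $-1$. Let $[X,Y]=\frac12(X\circ Y-Y\circ X)$, let $\mathcal D f\in\Gamma(E)$ be defined by $\langle\mathcal D f,X\rangle=\rho(X)f$, and put $T(X,Y,Z)=\frac16\left(\langle[X,Y],Z\rangle+\langle[Y,Z],X\rangle+\langle[Z,X],Y\rangle\right)$.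 Fix a sign $\varepsilon\in\{1,-1\}$. The structure on $V$ associated with a pre-Courant algebroid is $l_1+l_2+l_3$, where $l_1,l_2,l_3$ are the graded symmetric vector valued forms of degree $1$ given by $$l_1f=\mathcal D f,\quad l_2(X,Y)=[X,Y],\quad l_2(X,f)=l_2(f,X)=\tfrac12\langle X,\mathcal D f\rangle,\quad l_3(X,Y,Z)=\varepsilon\,T(X,Y,Z),$$ all other components being zero. A symmetric vector valued form of degree $d$ on $V$ is a formal sum $K=K_0+K_1+K_2+\cdots$ of graded symmetric $k$-linear maps $K_k:V^k\to V$ that raise the total degree by $d$. The insertion operator is the biadditive extension of $$\iota_KL(X_1,\dots,X_{k+l-1})=\sum_{\sigma\in Sh(k,l-1)}\epsilon(\sigma)\,L\big(K(X_{\sigma(1)},\dots,X_{\sigma(k)}),X_{\sigma(k+1)},\dots,X_{\sigma(k+l-1)}\big)$$ for a $k$-form $K$ and an $l$-form $L$, where $\epsilon(\sigma)$ is the Koszul sign (and $\iota_KL=0$ if $l=0$). The Richardson--Nijenhuis bracket is $[K,L]_{RN}=\iota_KL-(-1)^{\bar K\bar L}\iota_LK$, where $\bar K,\bar L$ are the degrees.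 A form $\mathcal N$ of degree $0$ is *Nijenhuis with respect to a form $\mu$ of degree $1$, with square $\mathcal K$* ($\mathcal K$ a form of degree $0$), if $[\mathcal N,[\mathcal N,\mu]_{RN}]_{RN}=[\mathcal K,\mu]_{RN}$ and $[\mathcal N,\mathcal K]_{RN}=0$. For a $(1,1)$-tensor $N$, i.e. a $C^\infty(M)$-linear map $N:\Gamma(E)\to\Gamma(E)$, let $N^*$ be its transpose with respect to $\langle\cdot,\cdot\rangle$. The deformation of a bracket is $X\circ^NY=NX\circ Y+X\circ NY-N(X\circ Y)$, and $\circ^{N,N}=(\circ^N)^N$. **Theorem.** Let $(E,\circ,\rho,\langle\cdot,\cdot\rangle)$ be a Courant algebroid whose anchor is nonzero on a dense subset of $E$, i.e. $\{v\in E:\rho(v)\ne0\}$ is dense in $E$, and let $\mu=l_1+l_2+l_3$ be the associated structure on $V$. Then there is a one-to-one correspondence between (i) the quadruples $(N,K,\lambda,\gamma)$ of two $(1,1)$-tensors $N,K$ and two Casimir functions $\lambda,\gamma$ with $$\circ^{N,N}=\circ^K,\qquad NK-KN=0,\qquad N+N^*=\lambda\,\mathrm{Id}_{\Gamma(E)},\qquad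 K+K^*=\gamma\,\mathrm{Id}_{\Gamma(E)};$$ (ii) the pairs $(\mathcal N,\mathcal K)$ of $C^\infty(M)$-multilinear symmetric vector valued forms of degree $0$ on $V$ such that $\mathcal N$ is Nijenhuis with respect to $\mu$ with square $\mathcal K$, and such that $[\mathcal N,\mu]_{RN}=l_1'+l_2'+l_3'$ is the structure associated (by the same construction) with some pre-Courant algebroid on $E$ with the same inner product. The correspondence sends $(N,K,\lambda,\gamma)$ to the pair of $1$-forms $\mathcal N,\mathcal K$ with $\mathcal N(f)=\lambda f$, $\mathcal N(X)=NX$, $\mathcal K(f)=\gamma f$, $\mathcal K(X)=KX$ for $f\in C^\infty(M)$ and $X\in\Gamma(E)$. -/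

import Mathlib

open Bundle
open scoped Manifold ContDiff

set_option linter.unusedSectionVars false

noncomputable section

/-! ### Symmetric vector valued forms and the Richardson-Nijenhuis bracket

`W` is a real vector space with a grading `𝒲 : ℤ → Submodule ℝ W`. -/

namespace RN

variable {W : Type*} [AddCommGroup W] [Module ℝ W]

variable (W) in
/-- A `k`-linear map from `W` to `W`. -/
abbrev KForm (k : ℕ) : Type _ := MultilinearMap ℝ (fun _ : Fin k => W) W

variable (W) in
/-- Formal sums `K₀ + K₁ + K₂ + ⋯`, with `Kₖ` a `k`-linear map from `W` to `W`. -/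
abbrev Form : Type _ := ∀ k : ℕ, KForm W k

variable (𝒲 : ℤ → Submodule ℝ W)

/-- Graded symmetry: `K (…, X, Y, …) = (-1) ^ (|X||Y|) K (…, Y, X, …)` for homogeneous arguments,
the exchanged arguments being adjacent. -/
def IsGradedSymm {k : ℕ} (K : KForm W k) : Prop :=
  ∀ (deg : Fin k → ℤ) (x : Fin k → W), (∀ j, x j ∈ 𝒲 (deg j)) →
    ∀ i j : Fin k, (j : ℕ) = i + 1 →
      K (fun a => x (Equiv.swap i j a)) = (deg i * deg j).negOnePow • K x

/-- `K` raises the total degree by `d`. -/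
def HasDegree (d : ℤ) {k : ℕ} (K : KForm W k) : Prop :=
  ∀ (deg : Fin k → ℤ) (x : Fin k → W), (∀ j, x j ∈ 𝒲 (deg j)) → K x ∈ 𝒲 ((∑ j, deg j) + d)

/-- `K = K₀ + K₁ + ⋯` is a symmetric vector valued form of degree `d`. -/
def IsSymmForm (d : ℤ) (K : Form W) : Prop :=
  ∀ k, IsGradedSymm 𝒲 (K k) ∧ HasDegree 𝒲 d (K k)

/-- `K = K₀ + K₁ + ⋯` is linear over `R` in each of its arguments. -/
def IsMultilinearOver (R : Type*) [SMul R W] (K : Form W) : Prop :=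
  ∀ (k : ℕ) (x : Fin k → W) (i : Fin k) (r : R),
    K k (Function.update x i (r • x i)) = r • K k x

section Bracket

variable [DirectSum.Decomposition 𝒲]

/-- The projection of `W` onto its even part (`b = 0`) or onto its odd part (`b = 1`). -/
def parityProj (b : ZMod 2) : W →ₗ[ℝ] W :=
  (DirectSum.toModule ℝ ℤ W fun i => if (i : ZMod 2) = b then (𝒲 i).subtype else 0) ∘ₗ
    (DirectSum.decomposeLinearEquiv 𝒲).toLinearMap

/-- The `(k,m)`-shuffles of `n = k + m` letters: bijections from the disjoint union of a first block
of `k` letters and a second block of `m` letters which increase on each block. -/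
def shuffles (k m n : ℕ) : Finset (Fin k ⊕ Fin m ≃ Fin n) :=
  {e | StrictMono (fun i => e (.inl i)) ∧ StrictMono (fun j => e (.inr j))}

/-- The Koszul sign of a shuffle, for arguments of parity `p`. The only inversions
of a shuffle are between the two blocks. -/
def koszulSign {k m n : ℕ} (e : Fin k ⊕ Fin m ≃ Fin n) (p : Fin n → ZMod 2) : ℤ :=
  ∏ i : Fin k, ∏ j : Fin m,
    if e (.inr j) < e (.inl i) ∧ p (e (.inl i)) = 1 ∧ p (e (.inr j)) = 1 then -1 else 1

/-- The map `(X₁, …, Xₙ) ↦ ∑ ε(σ) L (K (X_σ(1), …, X_σ(k)), X_σ(k+1), …, X_σ(n))`, the sum running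
over the `(k,m)`-shuffles. The Koszul sign depends on the parities of the
arguments, which are therefore decomposed into their even and odd parts. -/
def insertOne {k m : ℕ} (K : KForm W k) (L : KForm W (m + 1)) (n : ℕ) : KForm W n :=
  ∑ e ∈ shuffles k m n, ∑ p : Fin n → ZMod 2,
    koszulSign e p •
      (((L.curryLeft.compMultilinearMap K).uncurrySum).domDomCongr e).compLinearMap
        (fun a => parityProj 𝒲 (p a))

/-- The insertion operator `ι_K L`. (The insertion into a `0`-form vanishes.) -/
def insertion (K L : Form W) : Form W := fun n =>
  ∑ km ∈ Finset.HasAntidiagonal.antidiagonal n, insertOne 𝒲 (K km.1) (L (km.2 + 1)) n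

/-- The Richardson-Nijenhuis bracket `[K, L] = ι_K L - (-1) ^ (ab) ι_L K` of forms `K` of degree `a`
and `L` of degree `b`. -/
def bracket (a b : ℤ) (K L : Form W) : Form W :=
  insertion 𝒲 K L - (a * b).negOnePow • insertion 𝒲 L K

/-- `N` is a Nijenhuis vector valued form with respect to the form `μ` of degree `1`,
and `K` is a square of `N`. -/
def IsNijenhuisWithSquare (μ N K : Form W) : Prop :=
  IsSymmForm 𝒲 0 N ∧ IsSymmForm 𝒲 0 K ∧
    bracket 𝒲 0 1 N (bracket 𝒲 0 1 N μ) = bracket 𝒲 0 1 K μ ∧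
    bracket 𝒲 0 0 N K = 0

end Bracket

/-- A linear map, seen as a vector valued `1`-form. -/
def ofLinear (T : W →ₗ[ℝ] W) : Form W
  | 1 => T.compMultilinearMap (MultilinearMap.ofSubsingleton ℝ W W (0 : Fin 1) LinearMap.id)
  | _ => 0

section TwoTerm

variable (A B : Type*) [AddCommGroup A] [Module ℝ A] [AddCommGroup B] [Module ℝ B]

/-- The grading of `A ⊕ B` for which `A` is the component of degree `-2`, `B` is the component of
degree `-1`, and the other components vanish. -/
def twoTerm (i : ℤ) : Submodule ℝ (A × B) where
  carrier := {w | (i ≠ -2 → w.1 = 0) ∧ (i ≠ -1 → w.2 = 0)}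
  add_mem' := by
    rintro a b ⟨ha, ha'⟩ ⟨hb, hb'⟩
    exact ⟨fun h => by simp [ha h, hb h], fun h => by simp [ha' h, hb' h]⟩
  zero_mem' := by simp
  smul_mem' := by
    rintro c a ⟨ha, ha'⟩
    exact ⟨fun h => by simp [ha h], fun h => by simp [ha' h]⟩

/-- The decomposition of an element of `A ⊕ B` into its components. -/
def twoTermDecompose : A × B →ₗ[ℝ] DirectSum ℤ fun i => twoTerm A B i :=
  (DirectSum.lof ℝ ℤ (fun i => twoTerm A B i) (-2)) ∘ₗ
      ((LinearMap.inl ℝ A B ∘ₗ LinearMap.fst ℝ A B).codRestrict _ fun w => by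
        constructor <;> simp) +
    (DirectSum.lof ℝ ℤ (fun i => twoTerm A B i) (-1)) ∘ₗ
      ((LinearMap.inr ℝ A B ∘ₗ LinearMap.snd ℝ A B).codRestrict _ fun w => by
        constructor <;> simp)

instance : DirectSum.Decomposition (twoTerm A B) :=
  DirectSum.Decomposition.ofLinearMap _ (twoTermDecompose A B)
    (by
      apply LinearMap.ext
      rintro ⟨a, b⟩
      simp [twoTermDecompose, LinearMap.codRestrict])
    (by
      refine DirectSum.linearMap_ext ℝ fun i => LinearMap.ext ?_
      rintro ⟨⟨a, b⟩, h1, h2⟩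
      by_cases hi : i = -2
      · subst hi
        have hb : b = 0 := h2 (by norm_num)
        subst hb
        have : (⟨((0 : A), (0 : B)), (twoTerm A B (-1)).zero_mem⟩ : twoTerm A B (-1)) = 0 := rfl
        simp [twoTermDecompose, LinearMap.codRestrict, this]
      · have ha : a = 0 := h1 hi
        subst ha
        by_cases hi' : i = -1
        · subst hi'
          have : (⟨((0 : A), (0 : B)), (twoTerm A B (-2)).zero_mem⟩ : twoTerm A B (-2)) = 0 := rfl
          simp [twoTermDecompose, LinearMap.codRestrict, this]
        · have hb : b = 0 := h2 hi'
          subst hb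
          have : (⟨((0 : A), (0 : B)), ⟨h1, h2⟩⟩ : twoTerm A B i) = 0 := rfl
          rw [this, map_zero, map_zero])

end TwoTerm

end RN

/-! ### Vector bundles with a non-degenerate inner product, anchors -/

namespace Courant

section Geometry

variable {EM : Type*} [NormedAddCommGroup EM] [NormedSpace ℝ EM]
  {H : Type*} [TopologicalSpace H] (I : ModelWithCorners ℝ EM H)
  {M : Type*} [TopologicalSpace M] [ChartedSpace H M] [IsManifold I ∞ M]
  (F : Type*) [NormedAddCommGroup F] [NormedSpace ℝ F]
  (E : M → Type*) [TopologicalSpace (TotalSpace F E)]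
  [∀ x, TopologicalSpace (E x)] [∀ x, AddCommGroup (E x)] [∀ x, Module ℝ (E x)]
  [∀ x, IsTopologicalAddGroup (E x)] [∀ x, ContinuousSMul ℝ (E x)]
  [FiberBundle F E] [VectorBundle ℝ F E]

/-- A non-degenerate inner product on the vector bundle `E`: a smooth family of non-degenerate
symmetric bilinear forms on the fibres. -/
structure InnerProd where
  val : ∀ x, E x →L[ℝ] E x →L[ℝ] ℝ
  symm : ∀ x v w, val x v w = val x w v
  nondegenerate : ∀ x v, (∀ w, val x v w = 0) → v = 0
  contMDiff : ContMDiff I (I.prod 𝓘(ℝ, F →L[ℝ] F →L[ℝ] ℝ)) ∞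
    (fun x => TotalSpace.mk' (F →L[ℝ] F →L[ℝ] ℝ) (E := fun x => E x →L[ℝ] E x →L[ℝ] ℝ) x (val x))

/-- A smooth bundle map `E → TM` over the identity of `M`. -/
structure Anchor where
  val : ∀ x, E x →L[ℝ] TangentSpace I x
  contMDiff : ContMDiff I (I.prod 𝓘(ℝ, F →L[ℝ] EM)) ∞
    (fun x => TotalSpace.mk' (F →L[ℝ] EM) (E := fun x => E x →L[ℝ] TangentSpace I x) x (val x))

variable {I F E}

/-- The smooth sections of `E` form a module over the smooth functions. -/
instance : SMul C^∞⟮I, M; ℝ⟯ Cₛ^∞⟮I; F, E⟯ :=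
  ⟨fun f X => ⟨fun x => f x • X x, f.contMDiff.smul_section X.contMDiff⟩⟩

@[simp]
theorem smul_section_apply (f : C^∞⟮I, M; ℝ⟯) (X : Cₛ^∞⟮I; F, E⟯) (x : M) :
    (f • X) x = f x • X x := rfl

instance : Module C^∞⟮I, M; ℝ⟯ Cₛ^∞⟮I; F, E⟯ where
  one_smul X := by ext x; exact one_smul ℝ (X x)
  mul_smul f h X := by ext x; exact mul_smul (f x) (h x) (X x)
  smul_zero f := by ext x; exact smul_zero (f x)
  smul_add f X Y := by ext x; exact smul_add (f x) (X x) (Y x)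
  add_smul f h X := by ext x; exact add_smul (f x) (h x) (X x)
  zero_smul X := by ext x; exact zero_smul ℝ (X x)

namespace InnerProd

/-- The function `⟨X, Y⟩`. -/
def pair (g : InnerProd I F E) (X Y : Cₛ^∞⟮I; F, E⟯) : C^∞⟮I, M; ℝ⟯ :=
  ⟨fun x => g.val x (X x) (Y x), by
    have h : ContMDiff I (I.prod 𝓘(ℝ)) ∞ (fun x =>
        TotalSpace.mk' ℝ (E := Bundle.Trivial M ℝ) x (g.val x (X x) (Y x))) :=
      ContMDiff.clm_bundle_apply₂ (F₁ := F) (F₂ := F) g.contMDiff X.contMDiff Y.contMDiff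
    intro x
    have := h x
    simp only [contMDiffAt_totalSpace] at this
    exact this.2⟩

@[simp]
theorem pair_apply (g : InnerProd I F E) (X Y : Cₛ^∞⟮I; F, E⟯) (x : M) :
    g.pair X Y x = g.val x (X x) (Y x) := rfl

end InnerProd

namespace Anchor

theorem contMDiffAt_deriv (ρ : Anchor I F E) (f : C^∞⟮I, M; ℝ⟯) {X : ∀ x, E x} {x₀ : M}
    (hX : ContMDiffAt I (I.prod 𝓘(ℝ, F)) ∞ (fun x => TotalSpace.mk' F x (X x)) x₀) :
    ContMDiffAt I 𝓘(ℝ) ∞ (fun x => mvfderiv I f x (ρ.val x (X x))) x₀ := by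
  have h1 : ContMDiffAt I I.tangent ∞
      (fun x => (⟨x, ρ.val x (X x)⟩ : TangentBundle I M)) x₀ :=
    ContMDiffAt.clm_bundle_apply (F₁ := F) (F₂ := EM) (ρ.contMDiff x₀) hX
  have h2 : ContMDiff I.tangent 𝓘(ℝ).tangent ∞ (tangentMap I 𝓘(ℝ) f) :=
    f.contMDiff.contMDiff_tangentMap (by simp)
  have h3 := contMDiff_snd_tangentBundle_modelSpace (n := ∞) ℝ 𝓘(ℝ)
  exact (h3.comp h2).contMDiffAt.comp x₀ h1

/-- The function `ρ(X) f`. -/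
def deriv (ρ : Anchor I F E) (X : Cₛ^∞⟮I; F, E⟯) (f : C^∞⟮I, M; ℝ⟯) : C^∞⟮I, M; ℝ⟯ :=
  ⟨fun x => mvfderiv I f x (ρ.val x (X x)),
    fun x => ρ.contMDiffAt_deriv f (X.contMDiff x)⟩

@[simp]
theorem deriv_apply (ρ : Anchor I F E) (X : Cₛ^∞⟮I; F, E⟯) (f : C^∞⟮I, M; ℝ⟯) (x : M) :
    ρ.deriv X f x = mvfderiv I f x (ρ.val x (X x)) := rfl

end Anchor

section Operator

variable [FiniteDimensional ℝ F]

/-- On each fibre the linear form `v ↦ ρ(v) f` is represented by a vector. -/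
theorem exists_gradient (g : InnerProd I F E) (ρ : Anchor I F E) (f : C^∞⟮I, M; ℝ⟯) (x : M) :
    ∃ v : E x, ∀ w, g.val x v w = mvfderiv I f x (ρ.val x w) := by
  have e : E x ≃ₗ[ℝ] F := (trivializationAt F E x).linearEquivAt (R := ℝ) x
    (FiberBundle.mem_baseSet_trivializationAt' x)
  have : FiniteDimensional ℝ (E x) := e.symm.finiteDimensional
  let T : E x →ₗ[ℝ] Module.Dual ℝ (E x) :=
    LinearMap.mk₂ ℝ (fun v w => g.val x v w) (by simp) (by simp) (by simp) (by simp)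
  have hinj : Function.Injective T := by
    rw [injective_iff_map_eq_zero]
    intro v hv
    exact g.nondegenerate x v fun w => LinearMap.congr_fun hv w
  have hsurj : Function.Surjective T :=
    (LinearMap.injective_iff_surjective_of_finrank_eq_finrank
      (Subspace.dual_finrank_eq).symm).1 hinj
  let φ : Module.Dual ℝ (E x) :=
    (mvfderiv I f x).toLinearMap ∘ₗ (ρ.val x).toLinearMap
  obtain ⟨v, hv⟩ := hsurj φ
  exact ⟨v, fun w => LinearMap.congr_fun hv w⟩

variable [ContMDiffVectorBundle ∞ F E I]

/-- A family of vectors whose inner products with smooth local sections are smooth is smooth. -/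
theorem InnerProd.contMDiff_of_pair (g : InnerProd I F E) (s : ∀ x, E x)
    (hs : ∀ (Y : ∀ x, E x) (x₀ : M),
      ContMDiffAt I (I.prod 𝓘(ℝ, F)) ∞ (fun x => TotalSpace.mk' F x (Y x)) x₀ →
      ContMDiffAt I 𝓘(ℝ) ∞ (fun x => g.val x (s x) (Y x)) x₀) :
    ContMDiff I (I.prod 𝓘(ℝ, F)) ∞ (fun x => TotalSpace.mk' F x (s x)) := by
  intro x₀
  classical
  let e := trivializationAt F E x₀
  have hx₀ : x₀ ∈ e.baseSet := FiberBundle.mem_baseSet_trivializationAt' x₀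
  let b := Module.finBasis ℝ F
  let u := e.localFrame b
  have hu : ∀ i, ContMDiffAt I (I.prod 𝓘(ℝ, F)) ∞ (fun x => TotalSpace.mk' F x (u i x)) x₀ :=
    fun i => contMDiffAt_localFrame_of_mem ∞ e b i hx₀
  let G : M → Matrix (Fin (Module.finrank ℝ F)) (Fin (Module.finrank ℝ F)) ℝ :=
    fun x => Matrix.of fun i j => g.val x (u i x) (u j x)
  have hG : ∀ i j, ContMDiffAt I 𝓘(ℝ) ∞ (fun x => G x i j) x₀ := by
    intro i j
    have h : ContMDiffAt I (I.prod 𝓘(ℝ)) ∞ (fun x =>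
        TotalSpace.mk' ℝ (E := Bundle.Trivial M ℝ) x (g.val x (u i x) (u j x))) x₀ :=
      ContMDiffAt.clm_bundle_apply₂ (F₁ := F) (F₂ := F) (g.contMDiff x₀) (hu i) (hu j)
    simp only [contMDiffAt_totalSpace] at h
    exact h.2
  have hdet : ∀ A : M → Matrix (Fin (Module.finrank ℝ F)) (Fin (Module.finrank ℝ F)) ℝ,
      (∀ i j, ContMDiffAt I 𝓘(ℝ) ∞ (fun x => A x i j) x₀) →
      ContMDiffAt I 𝓘(ℝ) ∞ (fun x => (A x).det) x₀ := by
    intro A hA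
    simp only [Matrix.det_apply']
    refine contMDiffAt_finsetSum fun σ _ => contMDiffAt_const.mul ?_
    exact contMDiffAt_finsetProd fun i _ => hA _ _
  have hadj : ∀ i j, ContMDiffAt I 𝓘(ℝ) ∞ (fun x => (G x).adjugate i j) x₀ := by
    intro i j
    simp only [Matrix.adjugate_apply]
    refine hdet _ fun k l => ?_
    by_cases hk : k = j
    · subst hk
      simpa using contMDiffAt_const
    · simpa [Matrix.updateRow_ne hk] using hG k l
  have hdet0 : ∀ x ∈ e.baseSet, (G x).det ≠ 0 := by
    intro x hx h0
    obtain ⟨c, hc, hc0⟩ := Matrix.exists_vecMul_eq_zero_iff.2 h0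
    have hz : ∑ i, c i • u i x = 0 := by
      refine g.nondegenerate x _ fun w => ?_
      rw [← (e.basisAt b hx).sum_repr w, map_sum]
      refine Finset.sum_eq_zero fun j _ => ?_
      have := congrFun hc0 j
      simp only [Matrix.vecMul, dotProduct, G, Matrix.of_apply, Pi.zero_apply] at this
      rw [map_smul, ← e.localFrame_apply_of_mem_baseSet b hx]
      simp only [map_sum, map_smul, sum_apply, smul_apply]
      simp only [smul_eq_mul]
      rw [this, mul_zero]
    apply hc
    have hli := (e.basisAt b hx).linearIndependent
    rw [Fintype.linearIndependent_iff] at hli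
    funext i
    refine hli c ?_ i
    simpa [u, e.localFrame_apply_of_mem_baseSet b hx] using hz
  have hr : ∀ j, ContMDiffAt I 𝓘(ℝ) ∞ (fun x => g.val x (s x) (u j x)) x₀ :=
    fun j => hs _ _ (hu j)
  let c : Fin (Module.finrank ℝ F) → M → ℝ := fun i x =>
    ∑ j, g.val x (s x) (u j x) * ((G x).det⁻¹ * (G x).adjugate j i)
  have hc : ∀ i, ContMDiffAt I 𝓘(ℝ) ∞ (c i) x₀ := fun i =>
    contMDiffAt_finsetSum fun j _ =>
      (hr j).mul (((hdet G hG).inv₀ (hdet0 x₀ hx₀)).mul (hadj j i))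
  have hsum : ContMDiffAt I (I.prod 𝓘(ℝ, F)) ∞
      (fun x => TotalSpace.mk' F x (∑ i, c i x • u i x)) x₀ :=
    ContMDiffAt.sum_section fun i _ => (hc i).smul_section (hu i)
  refine hsum.congr_of_eventuallyEq ?_
  filter_upwards [e.open_baseSet.mem_nhds hx₀] with x hx
  congr 1
  rw [← sub_eq_zero]
  refine g.nondegenerate x _ fun w => ?_
  rw [← (e.basisAt b hx).sum_repr w, map_sum]
  refine Finset.sum_eq_zero fun j _ => ?_
  rw [map_smul, ← e.localFrame_apply_of_mem_baseSet b hx]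
  have key : ∑ i, c i x * G x i j = g.val x (s x) (u j x) := by
    have h1 : (Matrix.vecMul (Matrix.vecMul (fun j => g.val x (s x) (u j x)) (G x)⁻¹) (G x)) j
        = g.val x (s x) (u j x) := by
      rw [Matrix.vecMul_vecMul, Matrix.nonsing_inv_mul _ (isUnit_iff_ne_zero.2 (hdet0 x hx)),
        Matrix.vecMul_one]
    rw [← h1]
    simp only [Matrix.vecMul, dotProduct, c, Matrix.inv_def, Ring.inverse_eq_inv',
      Matrix.smul_apply, smul_eq_mul]
  simp only [map_sub, map_sum, map_smul, sub_apply,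
    sum_apply, smul_apply]
  simp only [smul_eq_mul]
  have key' : ∑ i, c i x * g.val x (u i x) (u j x) = g.val x (s x) (u j x) := key
  rw [key', sub_self, mul_zero]

theorem exists_D (g : InnerProd I F E) (ρ : Anchor I F E) (f : C^∞⟮I, M; ℝ⟯) :
    ∃ s : Cₛ^∞⟮I; F, E⟯, ∀ x w, g.val x (s x) w = mvfderiv I f x (ρ.val x w) := by
  choose s hs using exists_gradient g ρ f
  refine ⟨⟨s, g.contMDiff_of_pair s fun Y x₀ hY => ?_⟩, hs⟩
  simp only [hs]
  exact ρ.contMDiffAt_deriv f hY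

theorem InnerProd.ext_val (g : InnerProd I F E) {s t : Cₛ^∞⟮I; F, E⟯}
    (h : ∀ x w, g.val x (s x) w = g.val x (t x) w) : s = t := by
  ext x
  rw [← sub_eq_zero]
  exact g.nondegenerate x _ fun w => by simp [h x w]

theorem mvfderiv_coe_add (f h : C^∞⟮I, M; ℝ⟯) (x : M) :
    mvfderiv I (⇑(f + h)) x = mvfderiv I f x + mvfderiv I h x := by
  rw [ContMDiffMap.coe_add]
  exact mvfderiv_add f.mdifferentiableAt h.mdifferentiableAt

theorem mvfderiv_coe_smul (c : ℝ) (f : C^∞⟮I, M; ℝ⟯) (x : M) :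
    mvfderiv I (⇑(c • f)) x = c • mvfderiv I f x := by
  rw [ContMDiffMap.coe_smul]
  ext v
  simp only [mvfderiv, const_smul_mfderiv f.mdifferentiableAt c]
  rfl

/-- The gradient `𝒟 f`, given by `⟨𝒟 f, X⟩ = ρ(X) f`. -/
def gradient (g : InnerProd I F E) (ρ : Anchor I F E) (f : C^∞⟮I, M; ℝ⟯) : Cₛ^∞⟮I; F, E⟯ :=
  (exists_D g ρ f).choose

theorem val_gradient (g : InnerProd I F E) (ρ : Anchor I F E) (f : C^∞⟮I, M; ℝ⟯) (x : M) (w : E x) :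
    g.val x (gradient g ρ f x) w = mvfderiv I f x (ρ.val x w) :=
  (exists_D g ρ f).choose_spec x w

theorem gradient_add (g : InnerProd I F E) (ρ : Anchor I F E) (f h : C^∞⟮I, M; ℝ⟯) :
    gradient g ρ (f + h) = gradient g ρ f + gradient g ρ h := by
  refine g.ext_val fun x w => ?_
  rw [ContMDiffSection.coe_add, Pi.add_apply, map_add, add_apply, val_gradient, val_gradient,
    val_gradient, mvfderiv_coe_add, add_apply]

theorem gradient_smul (g : InnerProd I F E) (ρ : Anchor I F E) (c : ℝ) (f : C^∞⟮I, M; ℝ⟯) :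
    gradient g ρ (c • f) = c • gradient g ρ f := by
  refine g.ext_val fun x w => ?_
  rw [ContMDiffSection.coe_smul, Pi.smul_apply, map_smul, smul_apply, val_gradient, val_gradient,
    mvfderiv_coe_smul, smul_apply]

/-- The operator `𝒟 : C^∞(M) → Γ(E)`, given by `⟨𝒟 f, X⟩ = ρ(X) f`. -/
def D (g : InnerProd I F E) (ρ : Anchor I F E) : C^∞⟮I, M; ℝ⟯ →ₗ[ℝ] Cₛ^∞⟮I; F, E⟯ where
  toFun := gradient g ρ
  map_add' := gradient_add g ρ
  map_smul' := gradient_smul g ρ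

theorem pair_D (g : InnerProd I F E) (ρ : Anchor I F E) (f : C^∞⟮I, M; ℝ⟯) (X : Cₛ^∞⟮I; F, E⟯) :
    g.pair (D g ρ f) X = ρ.deriv X f := by
  ext x
  exact val_gradient g ρ f x (X x)

end Operator

/-- A pre-Courant algebroid `(E, ∘, ρ, ⟨·,·⟩)` with the given inner product. -/
structure PreCourant (g : InnerProd I F E) where
  anchor : Anchor I F E
  bracket : Cₛ^∞⟮I; F, E⟯ →ₗ[ℝ] Cₛ^∞⟮I; F, E⟯ →ₗ[ℝ] Cₛ^∞⟮I; F, E⟯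
  anchor_pair_left : ∀ X Y Z,
    anchor.deriv X (g.pair Y Z) = g.pair (bracket X Y) Z + g.pair Y (bracket X Z)
  anchor_pair_right : ∀ X Y Z,
    anchor.deriv X (g.pair Y Z) = g.pair X (bracket Y Z) + g.pair X (bracket Z Y)

/-- A Courant algebroid: the bracket of the sections is moreover a Leibniz bracket. -/
structure CourantAlgebroid (g : InnerProd I F E) extends PreCourant g where
  leibniz : ∀ X Y Z, bracket X (bracket Y Z) = bracket (bracket X Y) Z + bracket Y (bracket X Z)

/-- `f` is a Casimir function. -/
def PreCourant.IsCasimir {g : InnerProd I F E} (C : PreCourant g) (f : C^∞⟮I, M; ℝ⟯) : Prop :=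
  ∀ X, C.anchor.deriv X f = 0

variable (I F E) in
/-- `(1,1)`-tensors on `E`, as `C^∞(M)`-linear endomorphisms of the module of sections. -/
abbrev Tensor11 : Type _ := Cₛ^∞⟮I; F, E⟯ →ₗ[C^∞⟮I, M; ℝ⟯] Cₛ^∞⟮I; F, E⟯

/-- `N'` is the transpose `N^*` of `N`. -/
def IsTranspose (g : InnerProd I F E) (N N' : Tensor11 I F E) : Prop :=
  ∀ X Y, g.pair (N X) Y = g.pair X (N' Y)

/-- The deformation `X ∘^N Y = N X ∘ Y + X ∘ N Y - N (X ∘ Y)` of a bracket. -/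
def deform (N : Tensor11 I F E) (br : Cₛ^∞⟮I; F, E⟯ → Cₛ^∞⟮I; F, E⟯ → Cₛ^∞⟮I; F, E⟯) :
    Cₛ^∞⟮I; F, E⟯ → Cₛ^∞⟮I; F, E⟯ → Cₛ^∞⟮I; F, E⟯ :=
  fun X Y => br (N X) Y + br X (N Y) - N (br X Y)

/-! ### The associated `2`-term structure -/

variable (I F E) in
/-- The graded vector space `C^∞(M) ⊕ Γ(E)`. -/
abbrev Total : Type _ := C^∞⟮I, M; ℝ⟯ × Cₛ^∞⟮I; F, E⟯

variable (I F E) in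
/-- The grading of `C^∞(M) ⊕ Γ(E)`: functions have degree `-2` and sections have degree `-1`. -/
abbrev grading : ℤ → Submodule ℝ (Total I F E) :=
  RN.twoTerm C^∞⟮I, M; ℝ⟯ Cₛ^∞⟮I; F, E⟯

namespace InnerProd

/-- The inner product as an `ℝ`-bilinear map. -/
def pairₗ (g : InnerProd I F E) :
    Cₛ^∞⟮I; F, E⟯ →ₗ[ℝ] Cₛ^∞⟮I; F, E⟯ →ₗ[ℝ] C^∞⟮I, M; ℝ⟯ :=
  LinearMap.mk₂ ℝ g.pair
    (fun X X' Y => by ext x; simp) (fun c X Y => by ext x; simp)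
    (fun X Y Y' => by ext x; simp) (fun c X Y => by ext x; simp)

theorem pairₗ_apply (g : InnerProd I F E) (X Y : Cₛ^∞⟮I; F, E⟯) : g.pairₗ X Y = g.pair X Y := rfl

end InnerProd

section Associated

variable [FiniteDimensional ℝ F] [ContMDiffVectorBundle ∞ F E I]
variable {g : InnerProd I F E}

namespace PreCourant

/-- The skew-symmetric bracket `[X, Y] = (X ∘ Y - Y ∘ X) / 2`. -/
def skew (C : PreCourant g) (X Y : Cₛ^∞⟮I; F, E⟯) : Cₛ^∞⟮I; F, E⟯ :=
  (1 / 2 : ℝ) • (C.bracket X Y - C.bracket Y X)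

/-- The function `T(X, Y, Z) = ⟨[X, Y], Z⟩ / 6 + c.p.` -/
def T (C : PreCourant g) (X Y Z : Cₛ^∞⟮I; F, E⟯) : C^∞⟮I, M; ℝ⟯ :=
  (1 / 6 : ℝ) • (g.pair (C.skew X Y) Z + g.pair (C.skew Y Z) X + g.pair (C.skew Z X) Y)

/-- `l₁ f = 𝒟 f` on functions and `l₁ = 0` on sections. -/
def l₁ (C : PreCourant g) : RN.KForm (Total I F E) 1 :=
  MultilinearMap.mk' (fun v => (0, D g C.anchor (v 0).1))
    (by
      intro v i a b
      obtain rfl : i = 0 := Subsingleton.elim _ _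
      ext <;> simp)
    (by
      intro v i c a
      obtain rfl : i = 0 := Subsingleton.elim _ _
      ext <;> simp)

/-- `l₂(X, Y) = [X, Y]`, `l₂(X, f) = l₂(f, X) = ⟨X, 𝒟 f⟩ / 2`, and `l₂(f, h) = 0`. -/
def l₂ (C : PreCourant g) : RN.KForm (Total I F E) 2 :=
  MultilinearMap.mk'
    (fun v =>
      ((1 / 2 : ℝ) • g.pair (v 0).2 (D g C.anchor (v 1).1) +
        (1 / 2 : ℝ) • g.pair (v 1).2 (D g C.anchor (v 0).1),
        C.skew (v 0).2 (v 1).2))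
    (by
      intro v i a b
      fin_cases i <;>
      · simp only [← InnerProd.pairₗ_apply, skew]
        simp [Function.update]
        constructor <;> module)
    (by
      intro v i c a
      fin_cases i <;>
      · simp only [← InnerProd.pairₗ_apply, skew]
        simp [Function.update]
        constructor <;> module)

/-- `l₃(X, Y, Z) = ε T(X, Y, Z)`, and `l₃ = 0` as soon as one of the arguments is a function. -/
def l₃ (C : PreCourant g) (ε : ℤˣ) : RN.KForm (Total I F E) 3 :=
  MultilinearMap.mk' (fun v => (((ε : ℤ) : ℝ) • C.T (v 0).2 (v 1).2 (v 2).2, 0))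
    (by
      intro v i a b
      fin_cases i <;>
      · simp only [← InnerProd.pairₗ_apply, skew, T]
        simp [Function.update]
        module)
    (by
      intro v i c a
      fin_cases i <;>
      · simp only [← InnerProd.pairₗ_apply, skew, T]
        simp [Function.update]
        module)

/-- The form `l₁ + l₂ + l₃` on `C^∞(M) ⊕ Γ(E)` associated with a pre-Courant algebroid. The sign `ε`
is the sign with which `T` enters `l₃`; both conventions are allowed. For a Courant algebroid,
`[μ, μ] = 0` in the sign convention of the Richardson-Nijenhuis bracket above if `ε = -1`. -/
def form (C : PreCourant g) (ε : ℤˣ) : RN.Form (Total I F E)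
  | 1 => C.l₁
  | 2 => C.l₂
  | 3 => C.l₃ ε
  | _ => 0

end PreCourant

end Associated

/-- The vector valued `1`-form `λ + N`, equal to the multiplication by `λ` on
functions and to `N` on sections. -/
def oneForm (N : Tensor11 I F E) (lam : C^∞⟮I, M; ℝ⟯) : RN.Form (Total I F E) :=
  RN.ofLinear
    { toFun := fun w => (lam * w.1, N w.2)
      map_add' := fun v w => by simp [mul_add]
      map_smul' := fun c w => by
        have h : ∀ X : Cₛ^∞⟮I; F, E⟯, c • X = (algebraMap ℝ C^∞⟮I, M; ℝ⟯ c) • X := fun X => rfl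
        simp [h] }

/-! ### The two sets of data -/

/-- The quadruples `(N, K, λ, γ)` of two `(1,1)`-tensors and two Casimir functions with
`∘^{N,N} = ∘^K`, `N K - K N = 0`, `N + N^* = λ Id` and `K + K^* = γ Id`. -/
def IsNijenhuisQuadruple {g : InnerProd I F E} (C : PreCourant g) (N K : Tensor11 I F E)
    (lam gam : C^∞⟮I, M; ℝ⟯) : Prop :=
  C.IsCasimir lam ∧ C.IsCasimir gam ∧
    deform N (deform N fun X Y => C.bracket X Y) = deform K (fun X Y => C.bracket X Y) ∧
    N ∘ₗ K - K ∘ₗ N = 0 ∧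
    (∃ N' : Tensor11 I F E, IsTranspose g N N' ∧ N + N' = lam • LinearMap.id) ∧
    (∃ K' : Tensor11 I F E, IsTranspose g K K' ∧ K + K' = gam • LinearMap.id)

/-- `𝒩` is a Nijenhuis form with square `𝒦` for the structure `μ = l₁ + l₂ + l₃` associated with `C`,
both forms are `C^∞(M)`-linear, and the deformed structure `[𝒩, μ]` is the structure associated with
a pre-Courant algebroid with the same inner product. -/
def IsNijenhuisPair [FiniteDimensional ℝ F] [ContMDiffVectorBundle ∞ F E I]
    {g : InnerProd I F E} (C : PreCourant g) (ε : ℤˣ)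
    (𝒩 𝒦 : RN.Form (Total I F E)) : Prop :=
  RN.IsMultilinearOver C^∞⟮I, M; ℝ⟯ 𝒩 ∧ RN.IsMultilinearOver C^∞⟮I, M; ℝ⟯ 𝒦 ∧
    RN.IsNijenhuisWithSquare (grading I F E) (C.form ε) 𝒩 𝒦 ∧
    ∃ C' : PreCourant g, RN.bracket (grading I F E) 0 1 𝒩 (C.form ε) = C'.form ε

end Geometry

end Courant

end

namespace RN

/-! ### Insertion operators of low arity -/

section Insertion

variable {W : Type*} [AddCommGroup W] [Module ℝ W]

/-! Since $V$ lives in degrees $-2$ and $-1$, a form of degree $0$ has only two kinds of components: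
a $1$-form, and a $2$-form $\alpha$ taking two sections to a function (`HasDegree.eq_zero_of_ne`,
`HasDegree.eq_zero_of_two`). By $C^\infty(M)$-linearity the former is a pair $(N,\lambda)$
(`exists_oneForm`), and $\alpha$ is bilinear over functions and skew.

Suppose $[\mathcal N,\mu]$ is the structure of a pre-Courant algebroid with operator $\mathcal D'$
and skew bracket $[\cdot,\cdot]'$. Put $B(X,Y)=\langle NX,Y\rangle+\langle
X,NY\rangle-\lambda\langle X,Y\rangle$. The components on $f$, $(X,f)$ and $(X,Y)$ read $\mathcal
D'f=\mathcal D(\lambda f)-N\mathcal Df$, $B(X,\mathcal Df)=2\alpha(\mathcal Df,X)$ and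
$[X,Y]'=[NX,Y]+[X,NY]-N[X,Y]+\mathcal D\alpha(X,Y)$. Taking $f=1$ shows that $\lambda$ is a Casimir.
Replacing $Y$ by $fY$ in the last equation gives $B(X,\mathcal
Df)\,Y=(\frac12B(X,Y)-\alpha(X,Y))\,\mathcal Df$ (`defect_smul_eq`). Where $\mathcal Df\neq0$ this
forces $B(X,\mathcal Df)=0$, hence $\alpha=\frac12B$; being both skew and symmetric, both vanish
(`defect_apply_eq_zero`). Density of such points and continuity give $\alpha=0$ and $N+N^*=\lambda$
everywhere.

Conversely, if $N+N^*=\lambda$ with $\lambda$ a Casimir, then $[N+\lambda,\mu]$ is the structure of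
the pre-Courant algebroid with bracket $\circ^N$ and anchor $\rho\circ N$ (`bracket_oneForm_form`).
A structure and its bracket $\circ$ determine each other (`form_eq_of_bracket_eq`,
`bracket_eq_of_form_eq`), so the equation for the square becomes $\circ^{N,N}=\circ^K$. That
equation also says that $[\mathcal K,\mu]$ is an associated structure, so the analysis made for
$\mathcal N$ applies to $\mathcal K$ as well. -/

theorem shuffles_zero_right (k : ℕ) : shuffles k 0 k = {Equiv.sumEmpty (Fin k) (Fin 0)} := by
  ext e
  simp only [shuffles, Finset.mem_filter, Finset.mem_univ, true_and, Finset.mem_singleton]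
  constructor
  · rintro ⟨h, -⟩
    have hs : Function.Surjective fun i => e (Sum.inl i) := fun y =>
      ⟨Equiv.sumEmpty (Fin k) (Fin 0) (e.symm y), by
        change e ((Equiv.sumEmpty (Fin k) (Fin 0)).symm _) = y
        simp⟩
    have h1 : (fun i => e (Sum.inl i)) = id :=
      ((h.range_inj strictMono_id).1 (by rw [hs.range_eq, Set.range_id]))
    ext x
    rcases x with i | j
    · exact congrArg Fin.val (congrFun h1 i)
    · exact j.elim0
  · rintro rfl
    exact ⟨fun _ _ h => h, fun j => j.elim0⟩

/-- The shuffle which moves the letter `i` to the front. -/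
noncomputable def moveFront (m : ℕ) (i : Fin (m + 1)) : Fin 1 ⊕ Fin m ≃ Fin (m + 1) :=
  Equiv.ofBijective (Sum.elim (fun _ => i) i.succAbove) <| by
    constructor
    · rintro (a | a) (b | b) h
      · rw [Subsingleton.elim a b]
      · exact absurd h.symm (Fin.succAbove_ne i b)
      · exact absurd h (Fin.succAbove_ne i a)
      · rw [Fin.succAbove_right_injective h]
    · intro y
      rcases Fin.eq_self_or_eq_succAbove i y with rfl | ⟨j, rfl⟩
      · exact ⟨Sum.inl 0, rfl⟩
      · exact ⟨Sum.inr j, rfl⟩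

theorem moveFront_injective (m : ℕ) : Function.Injective (moveFront m) := fun _ _ h =>
  congrArg (fun e : Fin 1 ⊕ Fin m ≃ Fin (m + 1) => e (Sum.inl 0)) h

/-- A $(1,m)$-shuffle is determined by the letter in its first block: the second block is the
increasing enumeration of the others, and strictly increasing maps with the same range agree. -/
theorem shuffles_one_left (m : ℕ) :
    shuffles 1 m (m + 1) = Finset.univ.map ⟨moveFront m, moveFront_injective m⟩ := by
  ext e
  simp only [shuffles, Finset.mem_filter, Finset.mem_univ, true_and, Finset.mem_map,
    Function.Embedding.coeFn_mk]
  constructor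
  · rintro ⟨-, h⟩
    refine ⟨e (Sum.inl 0), ?_⟩
    have h1 : (fun j => e (Sum.inr j)) = (e (Sum.inl 0)).succAbove := by
      refine (h.range_inj (Fin.strictMono_succAbove _)).1 ?_
      rw [Fin.range_succAbove]
      ext y
      constructor
      · rintro ⟨j, rfl⟩ h
        simp at h
      · intro hy
        obtain ⟨a | j, rfl⟩ := e.surjective y
        · rw [Subsingleton.elim a 0] at hy
          exact absurd rfl hy
        · exact ⟨j, rfl⟩
    ext x
    rcases x with a | j
    · rw [Subsingleton.elim a 0]; rfl
    · exact congrArg Fin.val (congrFun h1 j).symm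
  · rintro ⟨i, rfl⟩
    refine ⟨fun a b h => absurd h (by rw [Subsingleton.elim a b]; exact lt_irrefl _), ?_⟩
    exact Fin.strictMono_succAbove i

variable (𝒲 : ℤ → Submodule ℝ W) [DirectSum.Decomposition 𝒲]

theorem parityProj_of_mem (b : ZMod 2) {i : ℤ} {w : W} (hw : w ∈ 𝒲 i) :
    parityProj 𝒲 b w = if (i : ZMod 2) = b then w else 0 := by
  simp only [parityProj, LinearMap.coe_comp, Function.comp_apply, LinearEquiv.coe_coe,
    DirectSum.decomposeLinearEquiv_apply, DirectSum.decompose_of_mem 𝒲 hw]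
  erw [DirectSum.toModule_lof]
  split_ifs <;> rfl

theorem insertOne_apply {k m n : ℕ} (K : KForm W k) (L : KForm W (m + 1)) (x : Fin n → W) :
    insertOne 𝒲 K L n x = ∑ e ∈ shuffles k m n, ∑ p : Fin n → ZMod 2, koszulSign e p •
      L (Fin.cons (K fun i => parityProj 𝒲 (p (e (.inl i))) (x (e (.inl i))))
        (fun j => parityProj 𝒲 (p (e (.inr j))) (x (e (.inr j))))) := by
  simp only [insertOne, sum_apply]
  rfl

/-- On homogeneous arguments no decomposition into even and odd parts is needed. -/
theorem insertOne_apply_of_mem {k m n : ℕ} (K : KForm W k) (L : KForm W (m + 1)) (x : Fin n → W)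
    (d : Fin n → ℤ) (hx : ∀ a, x a ∈ 𝒲 (d a)) :
    insertOne 𝒲 K L n x = ∑ e ∈ shuffles k m n, koszulSign e (fun a => (d a : ZMod 2)) •
      L (Fin.cons (K fun i => x (e (.inl i))) (fun j => x (e (.inr j)))) := by
  rw [insertOne_apply]
  refine Finset.sum_congr rfl fun e _ => ?_
  rw [Finset.sum_eq_single (fun a => (d a : ZMod 2))]
  · simp only [parityProj_of_mem 𝒲 _ (hx _), if_true]
  -- Any other choice of parities projects some argument to zero, which kills the term by
  -- multilinearity.
  · intro p _ hp
    obtain ⟨a, ha⟩ := Function.ne_iff.1 hp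
    have h0 : parityProj 𝒲 (p a) (x a) = 0 := by
      rw [parityProj_of_mem 𝒲 _ (hx a), if_neg (Ne.symm ha)]
    obtain ⟨i | j, rfl⟩ := e.surjective a
    · rw [K.map_coord_zero i h0, L.map_coord_zero 0 rfl, smul_zero]
    · rw [L.map_coord_zero j.succ (by simpa using h0), smul_zero]
  · simp

theorem insertOne_zero_right_apply {k : ℕ} (K : KForm W k) (L : KForm W 1) (x : Fin k → W)
    (d : Fin k → ℤ) (hx : ∀ a, x a ∈ 𝒲 (d a)) :
    insertOne (m := 0) 𝒲 K L k x = L ![K x] := by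
  rw [insertOne_apply_of_mem 𝒲 K L x d hx, shuffles_zero_right, Finset.sum_singleton]
  have : koszulSign (Equiv.sumEmpty (Fin k) (Fin 0)) (fun a => (d a : ZMod 2)) = 1 := by
    simp [koszulSign]
  rw [this, one_smul]
  congr 1
  funext i
  obtain rfl : i = 0 := Fin.fin_one_eq_zero i
  rfl

theorem insertOne_one_left_apply {m : ℕ} (K : KForm W 1) (L : KForm W (m + 1))
    (x : Fin (m + 1) → W) (d : Fin (m + 1) → ℤ) (hx : ∀ a, x a ∈ 𝒲 (d a)) :
    insertOne 𝒲 K L (m + 1) x = ∑ i : Fin (m + 1),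
      (∏ j : Fin m, if i.succAbove j < i ∧ (d i : ZMod 2) = 1 ∧ (d (i.succAbove j) : ZMod 2) = 1
        then (-1 : ℤ) else 1) • L (Fin.cons (K fun _ => x i) fun j => x (i.succAbove j)) := by
  rw [insertOne_apply_of_mem 𝒲 K L x d hx, shuffles_one_left, Finset.sum_map]
  refine Finset.sum_congr rfl fun i _ => ?_
  simp only [koszulSign, Fin.prod_univ_one]
  rfl

theorem insertOne_zero_form_left {k m : ℕ} (L : KForm W (m + 1)) (n : ℕ) :
    insertOne 𝒲 (0 : KForm W k) L n = 0 := by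
  ext x
  rw [insertOne_apply]
  refine Finset.sum_eq_zero fun e _ => Finset.sum_eq_zero fun p _ => ?_
  rw [L.map_coord_zero 0 rfl, smul_zero]

theorem insertOne_zero_form_right {k m : ℕ} (K : KForm W k) (n : ℕ) :
    insertOne 𝒲 K (0 : KForm W (m + 1)) n = 0 := by
  ext x
  rw [insertOne_apply]
  simp

/-! ### Components of the bracket with a form of degree `0` -/

theorem bracket_zero_apply (b : ℤ) (N μ : Form W) (n : ℕ) :
    bracket 𝒲 0 b N μ n = insertion 𝒲 N μ n - insertion 𝒲 μ N n := by
  simp [bracket]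

theorem insertion_of_arity_one_left {N : Form W} (hN : ∀ k, k ≠ 1 → N k = 0) (L : Form W) (m : ℕ) :
    insertion 𝒲 N L (m + 1) = insertOne 𝒲 (N 1) (L (m + 1)) (m + 1) := by
  rw [insertion, Finset.sum_eq_single (1, m)]
  · rintro ⟨k, l⟩ h h'
    rw [Finset.HasAntidiagonal.mem_antidiagonal] at h
    dsimp only at h ⊢
    have hk : k ≠ 1 := by
      rintro rfl
      exact h' (by rw [show l = m by omega])
    rw [hN k hk, insertOne_zero_form_left]
  · intro h
    exact absurd (Finset.HasAntidiagonal.mem_antidiagonal.2 (add_comm _ _)) h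

theorem insertion_of_arity_one_right {N : Form W} (hN : ∀ k, k ≠ 1 → N k = 0) (L : Form W) (n : ℕ) :
    insertion 𝒲 L N n = insertOne 𝒲 (L n) (N 1) n := by
  rw [insertion, Finset.sum_eq_single (n, 0)]
  · rintro ⟨k, l⟩ h h'
    rw [Finset.HasAntidiagonal.mem_antidiagonal] at h
    dsimp only at h ⊢
    have hl : l + 1 ≠ 1 := by
      rintro hl
      exact h' (by rw [show l = 0 by omega, show k = n by omega])
    rw [hN _ hl, insertOne_zero_form_right]
  · intro h
    exact absurd (Finset.HasAntidiagonal.mem_antidiagonal.2 (add_zero _)) h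

/-- Here and in `insertion_two` only the component of arity $0$ is assumed to vanish: the formulas
are also needed for a form whose $2$-form component has not yet been shown to be zero. -/
theorem insertion_one {N L : Form W} (hN : N 0 = 0) :
    insertion 𝒲 N L 1 = insertOne 𝒲 (N 1) (L 1) 1 := by
  simp [insertion, Finset.Nat.antidiagonal_succ, hN, insertOne_zero_form_left]

theorem insertion_two {N L : Form W} (hN : N 0 = 0) :
    insertion 𝒲 N L 2 = insertOne 𝒲 (N 1) (L 2) 2 + insertOne 𝒲 (N 2) (L 1) 2 := by
  simp [insertion, Finset.Nat.antidiagonal_succ, hN, insertOne_zero_form_left]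

theorem insertOne_one_left_two_apply (K : KForm W 1) (L : KForm W 2)
    (x : Fin 2 → W) (d : Fin 2 → ℤ) (hx : ∀ a, x a ∈ 𝒲 (d a)) :
    insertOne (m := 1) 𝒲 K L 2 x = L ![K ![x 0], x 1] +
      (if (d 1 : ZMod 2) = 1 ∧ (d 0 : ZMod 2) = 1 then (-1 : ℤ) else 1) • L ![K ![x 1], x 0] := by
  rw [insertOne_one_left_apply 𝒲 K L x d hx, Fin.sum_univ_two]
  congr 1
  · rw [Fin.prod_univ_one, if_neg (by simp), one_smul]
    congr 1
    funext a
    fin_cases a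
    · exact congrArg K (funext fun b => by rw [Subsingleton.elim b 0]; rfl)
    · rfl
  · congr 1
    · rw [Fin.prod_univ_one]
      exact if_congr (by simp) rfl rfl
    congr 1
    funext a
    fin_cases a
    · exact congrArg K (funext fun b => by rw [Subsingleton.elim b 0]; rfl)
    · rfl

/-- Bringing a letter to the front costs one sign for each odd letter it passes, whence the
alternating signs. -/
theorem insertOne_one_left_three_apply (K : KForm W 1) (L : KForm W 3)
    (x : Fin 3 → W) (d : Fin 3 → ℤ) (hx : ∀ a, x a ∈ 𝒲 (d a)) (hd : ∀ a, (d a : ZMod 2) = 1) :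
    insertOne (m := 2) 𝒲 K L 3 x =
      L ![K ![x 0], x 1, x 2] - L ![K ![x 1], x 0, x 2] + L ![K ![x 2], x 0, x 1] := by
  have h : ∀ (i : Fin 3) (y z : W), x (i.succAbove 0) = y → x (i.succAbove 1) = z →
      (Fin.cons (K fun _ => x i) (fun j => x (i.succAbove j)) : Fin 3 → W) =
        ![K ![x i], y, z] := by
    rintro i y z rfl rfl
    funext a
    fin_cases a
    · exact congrArg K (funext fun b => by rw [Subsingleton.elim b 0]; rfl)
    · rfl
    · rfl
  rw [insertOne_one_left_apply 𝒲 K L x d hx, Fin.sum_univ_three, h 0 (x 1) (x 2) rfl rfl,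
    h 1 (x 0) (x 2) rfl rfl, h 2 (x 0) (x 1) rfl rfl]
  simp only [Fin.prod_univ_two, hd, and_true]
  rw [if_neg (by decide), if_neg (by decide), if_pos (by decide), if_neg (by decide),
    if_pos (by decide), if_pos (by decide), one_mul, mul_one, neg_mul_neg, one_mul, one_smul,
    one_smul, neg_smul, one_smul, ← sub_eq_add_neg]

theorem bracket_one_apply (b : ℤ) {N μ : Form W} (hN : N 0 = 0) (hμ : μ 0 = 0)
    (x : Fin 1 → W) (d : Fin 1 → ℤ) (hx : ∀ a, x a ∈ 𝒲 (d a)) :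
    bracket 𝒲 0 b N μ 1 x = μ 1 ![N 1 x] - N 1 ![μ 1 x] := by
  rw [bracket_zero_apply, insertion_one 𝒲 hN, insertion_one 𝒲 hμ, sub_apply,
    insertOne_zero_right_apply _ _ _ x d hx, insertOne_zero_right_apply _ _ _ x d hx]

theorem bracket_two_apply (b : ℤ) {N μ : Form W} (hN : N 0 = 0) (hμ : μ 0 = 0)
    (x : Fin 2 → W) (d : Fin 2 → ℤ) (hx : ∀ a, x a ∈ 𝒲 (d a)) :
    bracket 𝒲 0 b N μ 2 x =
      μ 2 ![N 1 ![x 0], x 1] +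
        (if (d 1 : ZMod 2) = 1 ∧ (d 0 : ZMod 2) = 1 then (-1 : ℤ) else 1) •
          μ 2 ![N 1 ![x 1], x 0] + μ 1 ![N 2 x] -
      (N 2 ![μ 1 ![x 0], x 1] +
        (if (d 1 : ZMod 2) = 1 ∧ (d 0 : ZMod 2) = 1 then (-1 : ℤ) else 1) •
          N 2 ![μ 1 ![x 1], x 0] + N 1 ![μ 2 x]) := by
  rw [bracket_zero_apply, insertion_two 𝒲 hN, insertion_two 𝒲 hμ, sub_apply, add_apply, add_apply,
    insertOne_one_left_two_apply _ _ _ x d hx, insertOne_zero_right_apply _ _ _ x d hx,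
    insertOne_one_left_two_apply _ _ _ x d hx, insertOne_zero_right_apply _ _ _ x d hx]

theorem bracket_three_apply_of_odd (b : ℤ) {N : Form W} (hN : ∀ k, k ≠ 1 → N k = 0) (μ : Form W)
    (x : Fin 3 → W) (d : Fin 3 → ℤ) (hx : ∀ a, x a ∈ 𝒲 (d a)) (hd : ∀ a, (d a : ZMod 2) = 1) :
    bracket 𝒲 0 b N μ 3 x =
      μ 3 ![N 1 ![x 0], x 1, x 2] - μ 3 ![N 1 ![x 1], x 0, x 2] + μ 3 ![N 1 ![x 2], x 0, x 1] -
        N 1 ![μ 3 x] := by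
  rw [bracket_zero_apply, insertion_of_arity_one_right 𝒲 hN, insertion_of_arity_one_left 𝒲 hN,
    sub_apply, insertOne_one_left_three_apply _ _ _ x d hx hd,
    insertOne_zero_right_apply _ _ _ x d hx]

end Insertion

/-! ### Forms on a graded space `A ⊕ B` with components of degrees `-2` and `-1` -/

section TwoTerm

variable {A B : Type*} [AddCommGroup A] [Module ℝ A] [AddCommGroup B] [Module ℝ B]

theorem mk_zero_mem (a : A) : ((a, 0) : A × B) ∈ twoTerm A B (-2) := by constructor <;> simp

theorem zero_mk_mem (y : B) : ((0, y) : A × B) ∈ twoTerm A B (-1) := by constructor <;> simp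

theorem eq_zero_of_mem_twoTerm {i : ℤ} {w : A × B} (hw : w ∈ twoTerm A B i) (h1 : i ≠ -1)
    (h2 : i ≠ -2) : w = 0 := Prod.ext (hw.1 h2) (hw.2 h1)

/-- Multilinear maps on `A ⊕ B` are determined by their values on homogeneous arguments. -/
theorem kform_ext {n : ℕ} {K L : KForm (A × B) n}
    (h : ∀ (d : Fin n → ℤ) (x : Fin n → A × B), (∀ a, d a = -1 ∨ d a = -2) →
      (∀ a, x a ∈ twoTerm A B (d a)) → K x = L x) : K = L := by
  refine MultilinearMap.ext fun x => ?_
  -- Each argument is the sum of its two homogeneous components; the value is then expanded by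
  -- multilinearity.
  have hx : x = fun a => ∑ b : Fin 2, (![((x a).1, 0), (0, (x a).2)] b : A × B) := by
    funext a
    simp
  rw [hx, K.map_sum, L.map_sum]
  refine Finset.sum_congr rfl fun (r : Fin n → Fin 2) _ =>
    h (fun a => if r a = 0 then -2 else -1) _ ?_ ?_
  · intro a
    split_ifs <;> simp
  · intro a
    have : ∀ b : Fin 2, (![((x a).1, 0), (0, (x a).2)] b : A × B) ∈
        twoTerm A B (if b = 0 then -2 else -1) := by
      intro b
      fin_cases b
      · exact mk_zero_mem _
      · exact zero_mk_mem _
    exact this (r a)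

/-- A form of degree `0` vanishes as soon as the degrees of its arguments add up to less
than `-2`. -/
theorem HasDegree.apply_eq_zero {k : ℕ} {K : KForm (A × B) k} (hK : HasDegree (twoTerm A B) 0 K)
    {d : Fin k → ℤ} {x : Fin k → A × B} (hx : ∀ a, x a ∈ twoTerm A B (d a))
    (hd : ∑ a, d a ≠ -1) (hd' : ∑ a, d a ≠ -2) : K x = 0 :=
  eq_zero_of_mem_twoTerm (hK d x hx) (by simpa using hd) (by simpa using hd')

/-- The total degree of $k$ homogeneous arguments is at most $-k$, below $-2$ for $k\ge3$, and it is
$0$ for $k=0$; the space is zero in these degrees. -/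
theorem HasDegree.eq_zero_of_ne {k : ℕ} {K : KForm (A × B) k} (hK : HasDegree (twoTerm A B) 0 K)
    (h1 : k ≠ 1) (h2 : k ≠ 2) : K = 0 := by
  refine kform_ext fun d x hd hx => ?_
  have hs : ∑ a, d a ≤ ∑ _a : Fin k, (-1 : ℤ) :=
    Finset.sum_le_sum fun a _ => by rcases hd a with h | h <;> omega
  rcases Nat.eq_zero_or_pos k with rfl | hk
  · exact hK.apply_eq_zero hx (by simp) (by simp)
  · simp at hs
    exact hK.apply_eq_zero hx (by omega) (by omega)

/-- As soon as one of two arguments has degree $-2$, the total degree is at most $-3$. -/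
theorem HasDegree.eq_zero_of_two {K : KForm (A × B) 2} (hK : HasDegree (twoTerm A B) 0 K)
    (h : ∀ X Y : B, K ![(0, X), (0, Y)] = 0) : K = 0 := by
  refine kform_ext fun d x hd hx => ?_
  by_cases hall : ∀ a, d a = -1
  · have h0 : x = ![(0, (x 0).2), (0, (x 1).2)] := by
      funext a
      fin_cases a
      · exact Prod.ext ((hx 0).1 (by rw [hall]; norm_num)) rfl
      · exact Prod.ext ((hx 1).1 (by rw [hall]; norm_num)) rfl
    rw [h0, h]
    rfl
  · push Not at hall
    obtain ⟨a, ha⟩ := hall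
    have ha' := (hd a).resolve_left ha
    have h2 : ∑ a, d a ≤ -3 := by
      rw [Fin.sum_univ_two]
      have := hd 0
      have := hd 1
      fin_cases a <;> simp at ha' <;> omega
    exact hK.apply_eq_zero hx (by omega) (by omega)

end TwoTerm

end RN

namespace Courant

section Geometry

variable {EM : Type*} [NormedAddCommGroup EM] [NormedSpace ℝ EM] [FiniteDimensional ℝ EM]
  {H : Type*} [TopologicalSpace H] {I : ModelWithCorners ℝ EM H}
  {M : Type*} [TopologicalSpace M] [ChartedSpace H M] [IsManifold I ∞ M] [T2Space M]
  {F : Type*} [NormedAddCommGroup F] [NormedSpace ℝ F] [FiniteDimensional ℝ F]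
  {E : M → Type*} [TopologicalSpace (TotalSpace F E)]
  [∀ x, TopologicalSpace (E x)] [∀ x, AddCommGroup (E x)] [∀ x, Module ℝ (E x)]
  [∀ x, IsTopologicalAddGroup (E x)] [∀ x, ContinuousSMul ℝ (E x)]
  [FiberBundle F E] [VectorBundle ℝ F E] [ContMDiffVectorBundle ∞ F E I]

open Topology

/-! ### Global extensions of local data -/

theorem exists_cutoff {x₀ : M} {u : Set M} (hu : u ∈ 𝓝 x₀) :
    ∃ χ : C^∞⟮I, M; ℝ⟯, (∀ᶠ x in 𝓝 x₀, χ x = 1) ∧ tsupport χ ⊆ u := by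
  obtain ⟨f, hf, -⟩ := (SmoothBumpFunction.nhds_basis_support (I := I) hu).mem_iff.1 hu
  exact ⟨⟨f, f.contMDiff⟩, f.eventuallyEq_one, hf⟩

/-- A smooth local section agrees near a given point with a global one. -/
theorem exists_section_eventuallyEq {x₀ : M} {u : Set M} (hu : IsOpen u) (hx₀ : x₀ ∈ u)
    {s : ∀ x, E x} (hs : ContMDiffOn I (I.prod 𝓘(ℝ, F)) ∞ (fun x => TotalSpace.mk' F x (s x)) u) :
    ∃ X : Cₛ^∞⟮I; F, E⟯, ∀ᶠ x in 𝓝 x₀, X x = s x := by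
  obtain ⟨χ, h1, h2⟩ := exists_cutoff (I := I) (hu.mem_nhds hx₀)
  refine ⟨⟨_, ContMDiffOn.smul_section_of_tsupport χ.contMDiff.contMDiffOn hu h2 hs⟩, ?_⟩
  filter_upwards [h1] with x hx
  change χ x • s x = s x
  rw [hx, one_smul]

variable (I F) in
theorem exists_section_apply_eq {x₀ : M} (v : E x₀) : ∃ X : Cₛ^∞⟮I; F, E⟯, X x₀ = v := by
  obtain ⟨u, hu, hs⟩ := FiberBundle.exists_contMDiffOn_extend (k := ∞) I F v
  obtain ⟨X, hX⟩ := exists_section_eventuallyEq isOpen_interior (mem_interior_iff_mem_nhds.2 hu)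
    (hs.mono interior_subset)
  exact ⟨X, hX.self_of_nhds.trans (by simp)⟩

theorem sum_section_apply {ι : Type*} (s : Finset ι) (X : ι → Cₛ^∞⟮I; F, E⟯) (x : M) :
    (∑ i ∈ s, X i) x = ∑ i ∈ s, X i x := by
  change ContMDiffSection.coeAddHom I F ∞ E (∑ i ∈ s, X i) x = _
  rw [map_sum, Finset.sum_apply]
  rfl

/-- Operators on sections which are linear over the smooth functions act pointwise. -/
theorem Tensor11.apply_eq_zero (N : Tensor11 I F E) {X : Cₛ^∞⟮I; F, E⟯} {x₀ : M} (hX : X x₀ = 0) :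
    N X x₀ = 0 := by
  let e := trivializationAt F E x₀
  have hx₀ : x₀ ∈ e.baseSet := FiberBundle.mem_baseSet_trivializationAt' x₀
  let b := Module.finBasis ℝ F
  have : ContMDiffVectorBundle 1 F E I := ContMDiffVectorBundle.of_le (n := ∞) (by simp)
  obtain ⟨χ, h1, h2⟩ := exists_cutoff (I := I) (e.open_baseSet.mem_nhds hx₀)
  let U : Fin (Module.finrank ℝ F) → Cₛ^∞⟮I; F, E⟯ := fun i =>
    ⟨_, ContMDiffOn.smul_section_of_tsupport χ.contMDiff.contMDiffOn e.open_baseSet h2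
      (e.contMDiffOn_localFrame_baseSet (I := I) ∞ b i)⟩
  let c : Fin (Module.finrank ℝ F) → C^∞⟮I, M; ℝ⟯ := fun i =>
    ⟨fun x => χ x * e.localFrameCoeff I b i x (X x), contMDiff_of_tsupport fun x hx =>
      (χ.contMDiff x).mul (contMDiffAt_localFrameCoeff b
        (h2 (tsupport_mul_subset_left hx)) (X.contMDiff x) i)⟩
  -- One factor $\chi$ extends the coefficients of $X$ in the local frame to global functions, the
  -- other extends the frame to global sections. Linearity of $N$ over functions can then be used;
  -- at $x_0$ the coefficients vanish and $\chi=1$.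
  have key : (χ * χ) • X = ∑ i, c i • U i := by
    ext x
    rw [sum_section_apply]
    by_cases hx : x ∈ e.baseSet
    · have h3 := Bundle.Trivialization.eq_sum_localFrameCoeff_smul (I := I) (e := e) (b := b)
        (s := X) hx
      calc ((χ * χ) • X) x = (χ x * χ x) • X x := rfl
        _ = ∑ i, (χ x * e.localFrameCoeff I b i x (X x)) • (χ x • e.localFrame b i x) := by
          conv_lhs => rw [h3, Finset.smul_sum]
          refine Finset.sum_congr rfl fun i _ => ?_
          rw [smul_smul, smul_smul]
          ring_nf
    · have h0 : χ x = 0 := image_eq_zero_of_notMem_tsupport fun h => hx (h2 h)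
      rw [smul_section_apply]
      change (χ x * χ x) • X x = _
      rw [h0, mul_zero, zero_smul]
      refine (Finset.sum_eq_zero fun i _ => ?_).symm
      change (χ x * _) • (U i) x = 0
      rw [h0, zero_mul, zero_smul]
  have h3 := congrArg (fun Y : Cₛ^∞⟮I; F, E⟯ => Y x₀) (congrArg N key)
  have h4 : χ x₀ = 1 := h1.self_of_nhds
  simp only [map_smul, map_sum, sum_section_apply, smul_section_apply] at h3
  simpa [c, hX, h4] using h3

theorem Tensor11.apply_congr (N : Tensor11 I F E) {X Y : Cₛ^∞⟮I; F, E⟯} {x₀ : M}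
    (h : X x₀ = Y x₀) : N X x₀ = N Y x₀ := by
  have := N.apply_eq_zero (X := X - Y) (x₀ := x₀) (by simp [h])
  simpa [sub_eq_zero] using this

/-- The action of a `(1,1)`-tensor on a fibre. -/
noncomputable def Tensor11.fiber (N : Tensor11 I F E) (x : M) : E x →ₗ[ℝ] E x where
  toFun v := N (exists_section_apply_eq I F v).choose x
  map_add' v w := by
    rw [← Pi.add_apply, ← ContMDiffSection.coe_add, ← map_add]
    refine N.apply_congr ?_
    rw [ContMDiffSection.coe_add, Pi.add_apply]
    simp only [(exists_section_apply_eq I F _).choose_spec]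
  map_smul' c v := by
    change _ = (algebraMap ℝ C^∞⟮I, M; ℝ⟯ c • N _) x
    rw [← map_smul]
    refine N.apply_congr ?_
    rw [smul_section_apply, (exists_section_apply_eq I F _).choose_spec,
      (exists_section_apply_eq I F _).choose_spec]
    rfl

theorem Tensor11.fiber_apply (N : Tensor11 I F E) (X : Cₛ^∞⟮I; F, E⟯) (x : M) :
    N.fiber x (X x) = N X x :=
  N.apply_congr (exists_section_apply_eq I F _).choose_spec

/-- A family of linear maps from the fibres of `E` to the tangent spaces is smooth as soon as it
sends smooth sections to smooth vector fields. -/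
theorem contMDiff_hom_of_section (A : ∀ x, E x →L[ℝ] TangentSpace I x)
    (hA : ∀ X : Cₛ^∞⟮I; F, E⟯, ContMDiff I I.tangent ∞
      (fun x => (⟨x, A x (X x)⟩ : TangentBundle I M))) :
    ContMDiff I (I.prod 𝓘(ℝ, F →L[ℝ] EM)) ∞
      (fun x => TotalSpace.mk' (F →L[ℝ] EM) (E := fun x => E x →L[ℝ] TangentSpace I x) x (A x)) := by
  intro x₀
  rw [contMDiffAt_hom_bundle]
  refine ⟨contMDiffAt_id, ?_⟩
  let e := trivializationAt F E x₀
  have hx₀ : x₀ ∈ e.baseSet := FiberBundle.mem_baseSet_trivializationAt' x₀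
  let b := Module.finBasis ℝ F
  choose U hU using fun i => exists_section_eventuallyEq (I := I) e.open_baseSet hx₀
    (e.contMDiffOn_localFrame_baseSet (I := I) ∞ b i)
  let φ : M → F →L[ℝ] EM := fun x =>
    ContinuousLinearMap.inCoordinates F E EM (TangentSpace I) x₀ x x₀ x (A x)
  change ContMDiffAt I 𝓘(ℝ, F →L[ℝ] EM) ∞ φ x₀
  have hφ : ∀ i, ContMDiffAt I 𝓘(ℝ, EM) ∞ (fun x => φ x (b i)) x₀ := by
    intro i
    have h := (contMDiffAt_totalSpace.1 (hA (U i) x₀)).2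
    refine h.congr_of_eventuallyEq ?_
    filter_upwards [hU i, e.open_baseSet.mem_nhds hx₀,
      (trivializationAt EM (TangentSpace I) x₀).open_baseSet.mem_nhds
        (FiberBundle.mem_baseSet_trivializationAt' x₀)] with x h1 h2 h3
    have h4 : e.basisAt b h2 i = e.symm x (b i) := by simp [Bundle.Trivialization.basisAt]
    rw [h1, e.localFrame_apply_of_mem_baseSet b h2, h4]
    simp [φ, ContinuousLinearMap.inCoordinates_eq h2 h3, e]
  -- Expanding in the dual basis reduces smoothness of $\varphi$ to that of its values on basis
  -- vectors, which are the images of frame sections read in the trivializations.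
  have hsum : φ = fun x => ∑ i, (
      (LinearMap.toContinuousLinearMap (b.coord i)).smulRight (φ x (b i))) := by
    funext x
    refine ContinuousLinearMap.coe_injective (b.ext fun j => ?_)
    simp [Finsupp.single_apply]
  rw [hsum]
  refine contMDiffAt_finsetSum fun i _ => ?_
  exact ((ContinuousLinearMap.smulRightL ℝ F EM
    (LinearMap.toContinuousLinearMap (b.coord i))).contMDiff _).comp x₀ (hφ i)

/-- A coordinate of the chart centred at $x_0$, multiplied by a cutoff, does this: the chart has
identity derivative at its own base point, so the coordinate can be chosen not to kill $v$. -/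
theorem exists_mvfderiv_ne_zero {x₀ : M} {v : TangentSpace I x₀} (hv : v ≠ 0) :
    ∃ f : C^∞⟮I, M; ℝ⟯, mvfderiv I f x₀ v ≠ 0 := by
  let b := Module.finBasis ℝ EM
  obtain ⟨i, hi⟩ : ∃ i, b.coord i v ≠ 0 := by
    by_contra! h
    exact hv (b.ext_elem fun i => (h i).trans (map_zero (b.coord i)).symm)
  let ℓ : EM →L[ℝ] ℝ := LinearMap.toContinuousLinearMap (b.coord i)
  obtain ⟨χ, h1, h2⟩ := exists_cutoff (I := I) ((chartAt H x₀).open_source.mem_nhds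
    (mem_chart_source H x₀))
  refine ⟨⟨fun x => χ x * ℓ (extChartAt I x₀ x), contMDiff_of_tsupport fun x hx =>
    (χ.contMDiff x).mul ((ℓ.contMDiff _).comp x
      (contMDiffAt_extChartAt' (h2 (tsupport_mul_subset_left hx))))⟩, ?_⟩
  have h3 : (fun x => χ x * ℓ (extChartAt I x₀ x)) =ᶠ[𝓝 x₀] ℓ ∘ extChartAt I x₀ := by
    filter_upwards [h1] with x hx
    simp [hx]
  have h4 : mfderiv I 𝓘(ℝ) (ℓ ∘ extChartAt I x₀) x₀ = ℓ.comp (ContinuousLinearMap.id ℝ EM) := by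
    rw [mfderiv_comp x₀ ℓ.mdifferentiableAt (mdifferentiableAt_extChartAt (mem_chart_source H x₀)),
      mfderiv_extChartAt_self, ContinuousLinearMap.mfderiv_eq]
    rfl
  change mfderiv I 𝓘(ℝ) (fun x => χ x * ℓ (extChartAt I x₀ x)) x₀ v ≠ 0
  rw [h3.mfderiv_eq, h4]
  exact hi

/-! ### Calculus of the pairing and of the anchor -/

instance : IsScalarTower ℝ C^∞⟮I, M; ℝ⟯ Cₛ^∞⟮I; F, E⟯ :=
  ⟨fun c f X => by ext x; exact mul_smul c (f x) (X x)⟩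

namespace InnerProd

variable (g : InnerProd I F E)

theorem pair_add_left (X X' Y : Cₛ^∞⟮I; F, E⟯) : g.pair (X + X') Y = g.pair X Y + g.pair X' Y := by
  ext x; simp

theorem pair_add_right (X Y Y' : Cₛ^∞⟮I; F, E⟯) : g.pair X (Y + Y') = g.pair X Y + g.pair X Y' := by
  ext x; simp

theorem pair_sub_left (X X' Y : Cₛ^∞⟮I; F, E⟯) : g.pair (X - X') Y = g.pair X Y - g.pair X' Y := by
  ext x; simp

theorem pair_sub_right (X Y Y' : Cₛ^∞⟮I; F, E⟯) : g.pair X (Y - Y') = g.pair X Y - g.pair X Y' := by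
  ext x; simp

theorem pair_smul_left (f : C^∞⟮I, M; ℝ⟯) (X Y : Cₛ^∞⟮I; F, E⟯) :
    g.pair (f • X) Y = f * g.pair X Y := by
  ext x; simp

theorem pair_smul_right (f : C^∞⟮I, M; ℝ⟯) (X Y : Cₛ^∞⟮I; F, E⟯) :
    g.pair X (f • Y) = f * g.pair X Y := by
  ext x; simp

theorem pair_zero_left (Y : Cₛ^∞⟮I; F, E⟯) : g.pair 0 Y = 0 := by
  ext x; simp

theorem pair_zero_right (X : Cₛ^∞⟮I; F, E⟯) : g.pair X 0 = 0 := by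
  ext x; simp

theorem pair_comm (X Y : Cₛ^∞⟮I; F, E⟯) : g.pair X Y = g.pair Y X := by
  ext x; exact g.symm x _ _

theorem ext_pair {X Y : Cₛ^∞⟮I; F, E⟯} (h : ∀ Z, g.pair X Z = g.pair Y Z) : X = Y := by
  refine g.ext_val fun x w => ?_
  obtain ⟨Z, rfl⟩ := exists_section_apply_eq I F w
  exact congrArg (fun f : C^∞⟮I, M; ℝ⟯ => f x) (h Z)

end InnerProd

namespace Anchor

variable (ρ : Anchor I F E)

theorem deriv_add (X : Cₛ^∞⟮I; F, E⟯) (f h : C^∞⟮I, M; ℝ⟯) :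
    ρ.deriv X (f + h) = ρ.deriv X f + ρ.deriv X h := by
  ext x
  rw [ContMDiffMap.coe_add, Pi.add_apply]
  simp only [deriv_apply]
  rw [mvfderiv_coe_add, add_apply]

theorem deriv_mul (X : Cₛ^∞⟮I; F, E⟯) (f h : C^∞⟮I, M; ℝ⟯) :
    ρ.deriv X (f * h) = f * ρ.deriv X h + h * ρ.deriv X f := by
  ext x
  simp only [deriv_apply, ContMDiffMap.coe_mul, ContMDiffMap.coe_add, Pi.add_apply, Pi.mul_apply]
  rw [mvfderiv_mul f.mdifferentiableAt h.mdifferentiableAt]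
  simp

theorem deriv_one (X : Cₛ^∞⟮I; F, E⟯) : ρ.deriv X 1 = 0 := by
  have := ρ.deriv_mul X 1 1
  simpa using this

end Anchor

section Gradient

variable (g : InnerProd I F E) (ρ : Anchor I F E)

theorem D_mul (f h : C^∞⟮I, M; ℝ⟯) : D g ρ (f * h) = f • D g ρ h + h • D g ρ f := by
  refine g.ext_pair fun Z => ?_
  simp only [g.pair_add_left, g.pair_smul_left, pair_D, Anchor.deriv_mul]

theorem D_one : D g ρ 1 = 0 := by
  refine g.ext_pair fun Z => ?_
  rw [pair_D, Anchor.deriv_one, g.pair_zero_left]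

end Gradient

/-! ### Leibniz rules; the bracket and the associated form determine each other. -/

namespace PreCourant

variable {g : InnerProd I F E} (C : PreCourant g)

theorem isCasimir_iff (f : C^∞⟮I, M; ℝ⟯) : C.IsCasimir f ↔ D g C.anchor f = 0 := by
  constructor
  · intro h
    refine g.ext_pair fun Z => ?_
    rw [pair_D, h, g.pair_zero_left]
  · intro h X
    rw [← pair_D g, h, g.pair_zero_left]

theorem bracket_add_bracket_swap (X Y : Cₛ^∞⟮I; F, E⟯) :
    C.bracket X Y + C.bracket Y X = D g C.anchor (g.pair X Y) := by
  refine g.ext_pair fun Z => ?_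
  rw [pair_D, C.anchor_pair_right, g.pair_add_left, g.pair_comm Z, g.pair_comm Z]

/-- The second axiom fixes the symmetric part of $\circ$, so the data in $l_1$ and $l_2$ suffice to
recover $\circ$. -/
theorem bracket_eq_skew_add (X Y : Cₛ^∞⟮I; F, E⟯) :
    C.bracket X Y = C.skew X Y + (1 / 2 : ℝ) • D g C.anchor (g.pair X Y) := by
  rw [← C.bracket_add_bracket_swap, skew]
  module

/-- The Leibniz rule is not an axiom: it follows by differentiating $f\langle Y,Z\rangle$ along
$\rho(X)$ with the first axiom. -/
theorem bracket_smul_right (f : C^∞⟮I, M; ℝ⟯) (X Y : Cₛ^∞⟮I; F, E⟯) :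
    C.bracket X (f • Y) = f • C.bracket X Y + C.anchor.deriv X f • Y := by
  refine g.ext_pair fun Z => ?_
  have h1 := C.anchor_pair_left X (f • Y) Z
  have h2 := C.anchor_pair_left X Y Z
  simp only [g.pair_add_left, g.pair_smul_left, Anchor.deriv_mul] at h1 ⊢
  linear_combination f * h2 - h1

/-- The extra last term comes from the symmetric part $\frac12\mathcal D(f\langle X,Y\rangle)$. It
is the source of the half defect in `defect_smul_eq`. -/
theorem skew_smul_right (f : C^∞⟮I, M; ℝ⟯) (X Y : Cₛ^∞⟮I; F, E⟯) :
    C.skew X (f • Y) = f • C.skew X Y + C.anchor.deriv X f • Y -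
      (1 / 2 : ℝ) • g.pair X Y • D g C.anchor f := by
  have h1 := C.bracket_eq_skew_add X (f • Y)
  have h2 := C.bracket_eq_skew_add X Y
  rw [bracket_smul_right, g.pair_smul_right, D_mul] at h1
  rw [h2] at h1
  linear_combination (norm := module) -h1

/-- The bracket of a pre-Courant algebroid determines its anchor. -/
theorem deriv_eq_of_bracket_eq {C C' : PreCourant g} (h : C.bracket = C'.bracket)
    (X : Cₛ^∞⟮I; F, E⟯) (f : C^∞⟮I, M; ℝ⟯) : C.anchor.deriv X f = C'.anchor.deriv X f := by
  ext x
  by_cases hX : X x = 0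
  · simp [hX]
  · obtain ⟨w, hw⟩ : ∃ w, g.val x (X x) w ≠ 0 := by
      by_contra! h0
      exact hX (g.nondegenerate x _ h0)
    obtain ⟨Z, rfl⟩ := exists_section_apply_eq I F w
    -- Comparing the two expansions of $X\circ(fX)$ shows that the two derivatives of $f$ multiply
    -- $X$ to the same section; pairing with $Z$ cancels $X$ at $x$.
    have h1 := C.bracket_smul_right f X X
    have h2 := C'.bracket_smul_right f X X
    rw [h, h2] at h1
    have h3 := congrArg (fun Y => g.pair Y Z x) (add_left_cancel h1)
    simp only [g.pair_smul_left, ContMDiffMap.coe_mul, Pi.mul_apply] at h3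
    exact (mul_right_cancel₀ hw h3).symm

theorem D_eq_of_bracket_eq {C C' : PreCourant g} (h : C.bracket = C'.bracket) :
    D g C.anchor = D g C'.anchor := by
  ext1 f
  refine g.ext_pair fun Z => ?_
  rw [pair_D, pair_D, deriv_eq_of_bracket_eq h]

theorem form_eq_of_bracket_eq {C C' : PreCourant g} (h : C.bracket = C'.bracket) (ε : ℤˣ) :
    C.form ε = C'.form ε := by
  have h1 : C.skew = C'.skew := by
    unfold skew
    rw [h]
  have h2 : C.T = C'.T := by
    unfold T
    rw [h1]
  have hD := D_eq_of_bracket_eq h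
  funext k
  match k with
  | 0 => rfl
  | 1 => ext x <;> simp [form, l₁, hD]
  | 2 => ext x <;> simp [form, l₂, hD, h1]
  | 3 => ext x <;> simp [form, l₃, h2]
  | _ + 4 => rfl

theorem bracket_eq_of_form_eq {C C' : PreCourant g} {ε : ℤˣ} (h : C.form ε = C'.form ε) :
    C.bracket = C'.bracket := by
  have hD : ∀ f, D g C.anchor f = D g C'.anchor f := fun f =>
    congrArg Prod.snd (congrArg (fun K : RN.KForm (Total I F E) 1 => K ![(f, 0)]) (congrFun h 1))
  have hskew : ∀ X Y, C.skew X Y = C'.skew X Y := fun X Y => congrArg Prod.snd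
    (congrArg (fun K : RN.KForm (Total I F E) 2 => K ![(0, X), (0, Y)]) (congrFun h 2))
  ext1 X
  ext1 Y
  rw [bracket_eq_skew_add, bracket_eq_skew_add, hD, hskew]

/-! ### Deformation of a pre-Courant algebroid by a tensor with $N+N^*=\lambda$. -/

/-- The anchor of the deformed structure. -/
noncomputable def deformAnchor (N : Tensor11 I F E) : Anchor I F E where
  val x := (C.anchor.val x).comp
    { toLinearMap := N.fiber x
      cont := by
        have := FiberBundle.t2Space F E x
        have := VectorBundle.finiteDimensional ℝ F E x
        exact LinearMap.continuous_of_finiteDimensional _ }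
  contMDiff := contMDiff_hom_of_section _ fun X => by
    have h : ContMDiff I I.tangent ∞
        (fun x => (⟨x, C.anchor.val x (N X x)⟩ : TangentBundle I M)) := fun x =>
      ContMDiffAt.clm_bundle_apply (F₁ := F) (F₂ := EM) (C.anchor.contMDiff x) ((N X).contMDiff x)
    convert h using 3 with x
    exact congrArg _ (N.fiber_apply X x)

theorem deformAnchor_deriv (N : Tensor11 I F E) (X : Cₛ^∞⟮I; F, E⟯) (f : C^∞⟮I, M; ℝ⟯) :
    (C.deformAnchor N).deriv X f = C.anchor.deriv (N X) f := by
  ext x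
  exact congrArg (fun v => mvfderiv I f x (C.anchor.val x v)) (N.fiber_apply X x)

/-- The deformation of a pre-Courant algebroid by a `(1,1)`-tensor `N` such that `N + N^* = λ Id` for
a Casimir function `λ`. -/
noncomputable def deformed (N : Tensor11 I F E) (lam : C^∞⟮I, M; ℝ⟯) (hlam : C.IsCasimir lam)
    (hN : ∀ X Y, g.pair (N X) Y + g.pair X (N Y) = lam * g.pair X Y) : PreCourant g where
  anchor := C.deformAnchor N
  bracket := C.bracket ∘ₗ (N.restrictScalars ℝ) + C.bracket.compl₂ (N.restrictScalars ℝ) -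
    C.bracket.compr₂ (N.restrictScalars ℝ)
  anchor_pair_left X Y Z := by
    have h1 := C.anchor_pair_left (N X) Y Z
    have h2 := C.anchor_pair_left X (N Y) Z
    have h3 := C.anchor_pair_left X Y (N Z)
    have h4 := C.anchor_pair_left X Y Z
    -- Differentiating $N+N^*=\lambda$ produces the term $\langle Y,Z\rangle\,\rho(X)\lambda$; this
    -- is where $\lambda$ has to be a Casimir.
    have h5 := congrArg (C.anchor.deriv X) (hN Y Z)
    rw [Anchor.deriv_add, Anchor.deriv_mul, hlam] at h5
    have h6 := hN (C.bracket X Y) Z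
    have h7 := hN Y (C.bracket X Z)
    rw [C.deformAnchor_deriv]
    simp only [LinearMap.sub_apply, LinearMap.add_apply, LinearMap.comp_apply,
      LinearMap.compl₂_apply, LinearMap.compr₂_apply, LinearMap.restrictScalars_apply,
      g.pair_sub_left, g.pair_sub_right, g.pair_add_left, g.pair_add_right]
    linear_combination h1 + h2 + h3 - h5 - lam * h4 + h6 + h7
  anchor_pair_right X Y Z := by
    have h1 := C.anchor_pair_right (N X) Y Z
    have h2 := C.anchor_pair_right X (N Y) Z
    have h3 := C.anchor_pair_right X Y (N Z)
    have h4 := C.anchor_pair_right X Y Z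
    have h5 := congrArg (C.anchor.deriv X) (hN Y Z)
    rw [Anchor.deriv_add, Anchor.deriv_mul, hlam] at h5
    have h6 := hN X (C.bracket Y Z)
    have h7 := hN X (C.bracket Z Y)
    rw [C.deformAnchor_deriv]
    simp only [LinearMap.sub_apply, LinearMap.add_apply, LinearMap.comp_apply,
      LinearMap.compl₂_apply, LinearMap.compr₂_apply, LinearMap.restrictScalars_apply,
      g.pair_sub_right, g.pair_add_right]
    linear_combination h1 + h2 + h3 - h5 - lam * h4 + h6 + h7

theorem deformed_bracket {N : Tensor11 I F E} {lam : C^∞⟮I, M; ℝ⟯} (hlam : C.IsCasimir lam)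
    (hN : ∀ X Y, g.pair (N X) Y + g.pair X (N Y) = lam * g.pair X Y) (X Y : Cₛ^∞⟮I; F, E⟯) :
    (C.deformed N lam hlam hN).bracket X Y =
      C.bracket (N X) Y + C.bracket X (N Y) - N (C.bracket X Y) := rfl

theorem deformed_skew {N : Tensor11 I F E} {lam : C^∞⟮I, M; ℝ⟯} (hlam : C.IsCasimir lam)
    (hN : ∀ X Y, g.pair (N X) Y + g.pair X (N Y) = lam * g.pair X Y) (X Y : Cₛ^∞⟮I; F, E⟯) :
    (C.deformed N lam hlam hN).skew X Y = C.skew (N X) Y + C.skew X (N Y) - N (C.skew X Y) := by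
  simp only [skew, deformed_bracket, LinearMap.map_smul_of_tower, map_sub]
  module

/-- The new anchor is $\rho\circ N$, so the new operator is $N^*\mathcal D=(\lambda-N)\mathcal D$,
and $\lambda\mathcal Df=\mathcal D(\lambda f)$ for a Casimir $\lambda$. The right-hand side is the
form in which the bracket with $l_1$ produces it. -/
theorem deformed_D {N : Tensor11 I F E} {lam : C^∞⟮I, M; ℝ⟯} (hlam : C.IsCasimir lam)
    (hN : ∀ X Y, g.pair (N X) Y + g.pair X (N Y) = lam * g.pair X Y) (f : C^∞⟮I, M; ℝ⟯) :
    D g (C.deformed N lam hlam hN).anchor f = D g C.anchor (lam * f) - N (D g C.anchor f) := by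
  refine g.ext_pair fun Z => ?_
  have h1 := hN (D g C.anchor f) Z
  have h2 : (C.deformed N lam hlam hN).anchor.deriv Z f = _ := C.deformAnchor_deriv N Z f
  rw [pair_D, D_mul, (C.isCasimir_iff lam).1 hlam, h2, ← pair_D g, smul_zero, add_zero,
    g.pair_sub_left, g.pair_smul_left]
  linear_combination h1

/-- This allows a second deformation by the same $N$ and $\lambda$, as needed for $[\mathcal
N,[\mathcal N,\mu]]$. -/
theorem deformed_isCasimir {N : Tensor11 I F E} {lam : C^∞⟮I, M; ℝ⟯} (hlam : C.IsCasimir lam)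
    (hN : ∀ X Y, g.pair (N X) Y + g.pair X (N Y) = lam * g.pair X Y) {f : C^∞⟮I, M; ℝ⟯}
    (hf : C.IsCasimir f) : (C.deformed N lam hlam hN).IsCasimir f := fun X => by
  rw [show (C.deformed N lam hlam hN).anchor.deriv X f = _ from C.deformAnchor_deriv N X f, hf]

end PreCourant

/-! ### The bracket of a `1`-form with the structure of a pre-Courant algebroid -/

open RN

section Values

variable {g : InnerProd I F E} (C : PreCourant g)

theorem oneForm_one_apply (N : Tensor11 I F E) (lam : C^∞⟮I, M; ℝ⟯) (x : Fin 1 → Total I F E) :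
    oneForm N lam 1 x = (lam * (x 0).1, N (x 0).2) := rfl

theorem oneForm_of_ne_one (N : Tensor11 I F E) (lam : C^∞⟮I, M; ℝ⟯) (k : ℕ) (hk : k ≠ 1) :
    oneForm N lam k = 0 := by
  match k with
  | 0 => rfl
  | 1 => exact absurd rfl hk
  | _ + 2 => rfl

namespace PreCourant

theorem form_one_apply (ε : ℤˣ) (x : Fin 1 → Total I F E) :
    C.form ε 1 x = (0, D g C.anchor (x 0).1) := rfl

theorem form_two_apply (ε : ℤˣ) (x : Fin 2 → Total I F E) :
    C.form ε 2 x = ((1 / 2 : ℝ) • g.pair (x 0).2 (D g C.anchor (x 1).1) +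
        (1 / 2 : ℝ) • g.pair (x 1).2 (D g C.anchor (x 0).1), C.skew (x 0).2 (x 1).2) := rfl

theorem form_three_apply (ε : ℤˣ) (x : Fin 3 → Total I F E) :
    C.form ε 3 x = (((ε : ℤ) : ℝ) • C.T (x 0).2 (x 1).2 (x 2).2, 0) := rfl

theorem form_three_eq_zero (ε : ℤˣ) (x : Fin 3 → Total I F E) (a : Fin 3) (h : (x a).2 = 0) :
    C.form ε 3 x = 0 := by
  have : C.form ε 3 x = C.form ε 3 (fun i => (0, (x i).2)) := rfl
  rw [this]
  exact MultilinearMap.map_coord_zero _ a (by simp [h])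

theorem skew_swap (X Y : Cₛ^∞⟮I; F, E⟯) : C.skew X Y = -C.skew Y X := by
  simp only [skew]
  module

/-- In each cyclic term $-\langle
N[X,Y],Z\rangle=\langle[X,Y],NZ\rangle-\lambda\langle[X,Y],Z\rangle$, which supplies the missing
insertion of $N$ and the correction by $\lambda$. -/
theorem deformed_T {N : Tensor11 I F E} {lam : C^∞⟮I, M; ℝ⟯} (hlam : C.IsCasimir lam)
    (hN : ∀ X Y, g.pair (N X) Y + g.pair X (N Y) = lam * g.pair X Y) (X Y Z : Cₛ^∞⟮I; F, E⟯) :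
    (C.deformed N lam hlam hN).T X Y Z =
      C.T (N X) Y Z + C.T X (N Y) Z + C.T X Y (N Z) - lam * C.T X Y Z := by
  have h1 := hN (C.skew X Y) Z
  have h2 := hN (C.skew Y Z) X
  have h3 := hN (C.skew Z X) Y
  simp only [T, deformed_skew, g.pair_sub_left, g.pair_add_left, mul_smul_comm]
  rw [← smul_add, ← smul_add, ← smul_sub]
  congr 1
  linear_combination -h1 - h2 - h3

theorem T_swap_left (X Y Z : Cₛ^∞⟮I; F, E⟯) : C.T X Y Z = -C.T Y X Z := by
  have h : ∀ X Y Z, g.pair (C.skew X Y) Z = - g.pair (C.skew Y X) Z := fun X Y Z => by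
    ext x
    rw [C.skew_swap]
    simp
  simp only [T]
  rw [h X Y, h Y Z, h Z X, ← smul_neg]
  congr 1
  ring

theorem T_cycle (X Y Z : Cₛ^∞⟮I; F, E⟯) : C.T X Y Z = C.T Y Z X := by
  simp only [T]
  congr 1
  ring

end PreCourant

end Values

/-- The comparison is made arity by arity on homogeneous arguments: arities $1$ and $3$ are
`deformed_D` and `deformed_T`, and arity $2$ is `deformed_skew` on two sections and $N+N^*=\lambda$
on a section and a function. -/
theorem bracket_oneForm_form {g : InnerProd I F E} (C : PreCourant g) {N : Tensor11 I F E}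
    {lam : C^∞⟮I, M; ℝ⟯} (hlam : C.IsCasimir lam)
    (hN : ∀ X Y, g.pair (N X) Y + g.pair X (N Y) = lam * g.pair X Y) (ε : ℤˣ) :
    RN.bracket (grading I F E) 0 1 (oneForm N lam) (C.form ε) =
      (C.deformed N lam hlam hN).form ε := by
  have hDl := (C.isCasimir_iff lam).1 hlam
  have hN0 : oneForm N lam 0 = 0 := rfl
  have hN2 : oneForm N lam 2 = 0 := rfl
  have hC0 : C.form ε 0 = 0 := rfl
  funext k
  match k with
  | 0 =>
    rw [bracket_zero_apply, insertion_of_arity_one_right _ (oneForm_of_ne_one N lam), hC0,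
      insertOne_zero_form_left]
    simp [insertion, hN0, insertOne_zero_form_left]
    rfl
  | 1 =>
    refine kform_ext fun d x _ hx => ?_
    rw [bracket_one_apply _ _ hN0 hC0 x d hx]
    simp only [PreCourant.form_one_apply, oneForm_one_apply, PreCourant.deformed_D]
    ext1 <;> simp
  | 2 =>
    refine kform_ext fun d x hd hx => ?_
    rw [bracket_two_apply _ _ hN0 hC0 x d hx, hN2]
    simp only [PreCourant.form_two_apply, oneForm_one_apply, PreCourant.form_one_apply, zero_apply]
    have h0 := hx 0
    have h1 := hx 1
    have hD := C.deformed_D hlam hN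
    simp only [D_mul, hDl, smul_zero, add_zero] at hD
    rcases hd 0 with hd0 | hd0 <;> rcases hd 1 with hd1 | hd1 <;> rw [hd0] at h0 <;> rw [hd1] at h1
    · have e0 : (x 0).1 = 0 := h0.1 (by norm_num)
      have e1 : (x 1).1 = 0 := h1.1 (by norm_num)
      rw [if_pos (by rw [hd0, hd1]; decide)]
      ext1
      · simp [e0, e1, g.pair_zero_right]
      · simp [C.deformed_skew, C.skew_swap (N (x 1).2)]
    · have e0 : (x 0).1 = 0 := h0.1 (by norm_num)
      have e1 : (x 1).2 = 0 := h1.2 (by norm_num)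
      rw [if_neg (by rw [hd0, hd1]; decide)]
      ext1
      · have h2 := hN (x 0).2 (D g C.anchor (x 1).1)
        simp [e0, e1, g.pair_zero_right, hD, D_mul, hDl, g.pair_smul_right,
          g.pair_sub_right]
        exact eq_sub_of_add_eq h2
      · simp [e1, PreCourant.skew]
    · have e0 : (x 0).2 = 0 := h0.2 (by norm_num)
      have e1 : (x 1).1 = 0 := h1.1 (by norm_num)
      rw [if_neg (by rw [hd0, hd1]; decide)]
      ext1
      · have h2 := hN (x 1).2 (D g C.anchor (x 0).1)
        simp [e0, e1, g.pair_zero_right, hD, D_mul, hDl, g.pair_smul_right,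
          g.pair_sub_right]
        exact eq_sub_of_add_eq h2
      · simp [e0, PreCourant.skew]
    · have e0 : (x 0).2 = 0 := h0.2 (by norm_num)
      have e1 : (x 1).2 = 0 := h1.2 (by norm_num)
      rw [if_neg (by rw [hd0, hd1]; decide)]
      ext1
      · simp [e0, e1, g.pair_zero_left]
      · simp [e0, e1, PreCourant.skew]
  | 3 =>
    refine kform_ext fun d x hd hx => ?_
    by_cases h : ∀ a, d a = -1
    · rw [bracket_three_apply_of_odd _ _ (oneForm_of_ne_one N lam) _ x d hx (by simp [h])]
      simp only [PreCourant.form_three_apply, oneForm_one_apply, PreCourant.deformed_T]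
      ext1
      · simp
        rw [C.T_swap_left (N (x 1).2), C.T_cycle (N (x 2).2)]
        module
      · simp
    · push Not at h
      obtain ⟨a, ha⟩ := h
      have hxa : (x a).2 = 0 := (hx a).2 ha
      rw [bracket_zero_apply, insertion_of_arity_one_right _ (oneForm_of_ne_one N lam),
        insertion_of_arity_one_left _ (oneForm_of_ne_one N lam),
        PreCourant.form_three_eq_zero _ _ _ a hxa, sub_apply,
        insertOne_zero_right_apply _ _ _ x d hx, insertOne_one_left_apply _ _ _ x d hx,
        PreCourant.form_three_eq_zero _ _ _ a hxa, oneForm_one_apply]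
      rw [Finset.sum_eq_zero, zero_sub]
      · simp
      -- A $1$-form of degree $0$ sends functions to functions, so each term of the insertion still
      -- has a function among the arguments of $l_3$.
      · intro i _
        rcases Fin.eq_self_or_eq_succAbove i a with rfl | ⟨j, rfl⟩
        · rw [PreCourant.form_three_eq_zero _ _ _ 0, smul_zero]
          simp [oneForm_one_apply, hxa]
        · rw [PreCourant.form_three_eq_zero _ _ _ j.succ, smul_zero]
          simpa using hxa
  | k + 4 =>
    have h : ∀ C : PreCourant g, C.form ε (k + 4) = 0 := fun _ => rfl
    rw [bracket_zero_apply, insertion_of_arity_one_right _ (oneForm_of_ne_one N lam),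
      insertion_of_arity_one_left _ (oneForm_of_ne_one N lam), h, h, insertOne_zero_form_left,
      insertOne_zero_form_right, sub_zero]

/-! ### Deformations which are again pre-Courant structures -/

section Defect

variable (g : InnerProd I F E)

/-- The function `⟨(N + N^* - λ) X, Y⟩`. -/
noncomputable def defect (N : Tensor11 I F E) (lam : C^∞⟮I, M; ℝ⟯) (X Y : Cₛ^∞⟮I; F, E⟯) :
    C^∞⟮I, M; ℝ⟯ :=
  g.pair (N X) Y + g.pair X (N Y) - lam * g.pair X Y

theorem defect_swap (N : Tensor11 I F E) (lam : C^∞⟮I, M; ℝ⟯) (X Y : Cₛ^∞⟮I; F, E⟯) :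
    defect g N lam X Y = defect g N lam Y X := by
  simp only [defect]
  rw [g.pair_comm (N X), g.pair_comm X (N Y), g.pair_comm X Y]
  ring

/-- Because $N$ acts fibrewise, the defect at a point sees only the values there; this makes it
usable when sections are proportional at one point only. -/
theorem defect_apply_of_apply_eq_smul (N : Tensor11 I F E) (lam : C^∞⟮I, M; ℝ⟯)
    {X Z : Cₛ^∞⟮I; F, E⟯} (Y : Cₛ^∞⟮I; F, E⟯) {x : M} {c : ℝ} (h : X x = c • Z x) :
    defect g N lam X Y x = c * defect g N lam Z Y x := by
  have h1 : N X x = c • N Z x := by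
    rw [N.apply_congr (Y := c • Z) h, LinearMap.map_smul_of_tower]
    rfl
  change g.val x (N X x) (Y x) + g.val x (X x) (N Y x) - lam x * g.val x (X x) (Y x) =
    c * (g.val x (N Z x) (Y x) + g.val x (Z x) (N Y x) - lam x * g.val x (Z x) (Y x))
  rw [h1, h]
  simp only [map_smul, smul_apply, smul_eq_mul]
  ring

end Defect

namespace PreCourant

variable {g : InnerProd I F E} {C C' : PreCourant g} {N : Tensor11 I F E} {lam : C^∞⟮I, M; ℝ⟯}
  {α : Cₛ^∞⟮I; F, E⟯ → Cₛ^∞⟮I; F, E⟯ → C^∞⟮I, M; ℝ⟯}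

/-- Substitute $fY$ for $Y$ in the formula for the new skew bracket. The terms with $f$
undifferentiated cancel, as do those along $NY$ and $N\mathcal Df$; what remains is along $Y$ and
$\mathcal Df$. -/
theorem defect_smul_eq
    (hα : ∀ (f : C^∞⟮I, M; ℝ⟯) X Y, α X (f • Y) = f * α X Y)
    (h1 : ∀ f, D g C'.anchor f = lam • D g C.anchor f - N (D g C.anchor f))
    (h3 : ∀ X Y, C'.skew X Y =
      C.skew (N X) Y + C.skew X (N Y) - N (C.skew X Y) + D g C.anchor (α X Y))
    (X Y : Cₛ^∞⟮I; F, E⟯) (f : C^∞⟮I, M; ℝ⟯) :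
    defect g N lam X (D g C.anchor f) • Y =
      ((1 / 2 : ℝ) • defect g N lam X Y - α X Y) • D g C.anchor f := by
  have h4 := h3 X (f • Y)
  rw [hα, D_mul, map_smul, skew_smul_right, skew_smul_right, skew_smul_right, skew_smul_right,
    h3 X Y, ← pair_D g, ← pair_D g, ← pair_D g, h1] at h4
  simp only [map_add, map_sub, map_smul, LinearMap.map_smul_of_tower, g.pair_sub_left,
    g.pair_smul_left] at h4
  rw [Algebra.smul_def (1 / 2 : ℝ) (defect g N lam X Y)]
  simp only [defect, g.pair_comm _ (D g C.anchor f), g.pair_comm X (N (D g C.anchor f))]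
  linear_combination (norm := module) -h4

theorem defect_apply_eq_zero
    (hα : ∀ (f : C^∞⟮I, M; ℝ⟯) X Y, α X (f • Y) = f * α X Y)
    (hα' : ∀ X Y, α X Y = -α Y X)
    (h1 : ∀ f, D g C'.anchor f = lam • D g C.anchor f - N (D g C.anchor f))
    (h2 : ∀ X f, defect g N lam X (D g C.anchor f) = 2 * α (D g C.anchor f) X)
    (h3 : ∀ X Y, C'.skew X Y =
      C.skew (N X) Y + C.skew X (N Y) - N (C.skew X Y) + D g C.anchor (α X Y))
    {x : M} {f : C^∞⟮I, M; ℝ⟯} (hx : D g C.anchor f x ≠ 0) (X Y : Cₛ^∞⟮I; F, E⟯) :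
    defect g N lam X Y x = 0 ∧ α X Y x = 0 := by
  have hαx : ∀ X Y, α X Y x = -α Y X x := fun X Y =>
    congrArg (fun f : C^∞⟮I, M; ℝ⟯ => f x) (hα' X Y)
  have key : ∀ X Y, defect g N lam X (D g C.anchor f) x • Y x =
      (1 / 2 * defect g N lam X Y x - α X Y x) • D g C.anchor f x := fun X Y =>
    congrArg (fun Z : Cₛ^∞⟮I; F, E⟯ => Z x) (defect_smul_eq hα h1 h3 X Y f)
  have hself : defect g N lam (D g C.anchor f) (D g C.anchor f) x = 0 := by
    have := congrArg (fun f : C^∞⟮I, M; ℝ⟯ => f x) (h2 (D g C.anchor f) f)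
    have h0 : α (D g C.anchor f) (D g C.anchor f) x = 0 := by
      linarith [hαx (D g C.anchor f) (D g C.anchor f)]
    refine this.trans ?_
    change (2 : C^∞⟮I, M; ℝ⟯) x * _ = 0
    rw [h0, mul_zero]
  -- If this were nonzero, `key` with $Y=X$ would make $X$ proportional to $\mathcal Df$ at $x$, and
  -- `hself` would give zero after all. The argument needs no lower bound on the rank.
  have hgrad : ∀ X, defect g N lam X (D g C.anchor f) x = 0 := by
    intro X
    by_contra h
    have h4 : X x = ((defect g N lam X (D g C.anchor f) x)⁻¹ *
        (1 / 2 * defect g N lam X X x - α X X x)) • D g C.anchor f x := by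
      rw [mul_smul, ← key X X, inv_smul_smul₀ h]
    apply h
    rw [defect_apply_of_apply_eq_smul g N lam _ h4, hself, mul_zero]
  have hhalf : ∀ X Y, 1 / 2 * defect g N lam X Y x = α X Y x := by
    intro X Y
    have h4 := key X Y
    rw [hgrad, zero_smul] at h4
    exact sub_eq_zero.1 ((smul_eq_zero.1 h4.symm).resolve_right hx)
  -- The defect is symmetric and $\alpha$ is skew, so $\alpha=\frac12B$ kills both.
  have h4 := hhalf X Y
  have h5 := hhalf Y X
  rw [defect_swap g N lam Y X, hαx Y X] at h5
  constructor <;> linarith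

variable (C) in
/-- If the anchor is nonzero on a dense set, then so are, over a dense set of points, the
gradients. -/
theorem dense_gradient_ne_zero (hρ : Dense {v : TotalSpace F E | C.anchor.val v.1 v.2 ≠ 0}) :
    Dense {x : M | ∃ f, D g C.anchor f x ≠ 0} := by
  have hr : Function.Surjective (TotalSpace.proj : TotalSpace F E → M) := fun x => ⟨⟨x, 0⟩, rfl⟩
  -- A continuous surjection maps dense sets to dense sets; and $\rho(v)\neq0$ is detected by some
  -- $f$, for which $\mathcal Df$ pairs nontrivially with $v$.
  refine (hr.denseRange.dense_image (FiberBundle.continuous_proj F E) hρ).mono ?_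
  rintro _ ⟨⟨x, v⟩, hv, rfl⟩
  obtain ⟨f, hf⟩ := exists_mvfderiv_ne_zero hv
  refine ⟨f, fun h => hf ?_⟩
  rw [← val_gradient g C.anchor f x v]
  change g.val x (D g C.anchor f x) v = 0
  rw [h]
  simp

theorem defect_eq_zero (hρ : Dense {v : TotalSpace F E | C.anchor.val v.1 v.2 ≠ 0})
    (hα : ∀ (f : C^∞⟮I, M; ℝ⟯) X Y, α X (f • Y) = f * α X Y)
    (hα' : ∀ X Y, α X Y = -α Y X)
    (h1 : ∀ f, D g C'.anchor f = lam • D g C.anchor f - N (D g C.anchor f))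
    (h2 : ∀ X f, defect g N lam X (D g C.anchor f) = 2 * α (D g C.anchor f) X)
    (h3 : ∀ X Y, C'.skew X Y =
      C.skew (N X) Y + C.skew X (N Y) - N (C.skew X Y) + D g C.anchor (α X Y))
    (X Y : Cₛ^∞⟮I; F, E⟯) : defect g N lam X Y = 0 ∧ α X Y = 0 := by
  have hd := C.dense_gradient_ne_zero hρ
  constructor <;> refine DFunLike.coe_injective (Continuous.ext_on hd
    (ContMDiffMap.contMDiff _).continuous (ContMDiffMap.contMDiff _).continuous ?_)
  · rintro x ⟨f, hf⟩
    exact (defect_apply_eq_zero hα hα' h1 h2 h3 hf X Y).1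
  · rintro x ⟨f, hf⟩
    exact (defect_apply_eq_zero hα hα' h1 h2 h3 hf X Y).2

end PreCourant

/-! ### From forms to tensors and functions, and the bijection. -/

section Components

variable {g : InnerProd I F E}

/-- A `1`-form of degree `0` which is linear over the smooth functions is given by a `(1,1)`-tensor
and a function. -/
theorem exists_oneForm {𝒩 : Form (Total I F E)} (hs : HasDegree (grading I F E) 0 (𝒩 1))
    (hm : IsMultilinearOver C^∞⟮I, M; ℝ⟯ 𝒩) :
    ∃ (N : Tensor11 I F E) (lam : C^∞⟮I, M; ℝ⟯), 𝒩 1 = oneForm N lam 1 := by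
  have hu : ∀ v w : Total I F E, Function.update ![v] 0 w = ![w] := fun v w => by
    funext a
    rw [Subsingleton.elim a 0, Function.update_self]
    rfl
  have hsmul : ∀ (r : C^∞⟮I, M; ℝ⟯) (w : Total I F E), 𝒩 1 ![r • w] = r • 𝒩 1 ![w] := by
    intro r w
    have h := hm 1 ![w] 0 r
    rwa [hu, Matrix.cons_val_zero] at h
  have hadd : ∀ (v w : Total I F E), 𝒩 1 ![v + w] = 𝒩 1 ![v] + 𝒩 1 ![w] := by
    intro v w
    have h := (𝒩 1).map_update_add ![v] 0 v w
    rwa [hu, hu, hu] at h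
  have hf : ∀ f : C^∞⟮I, M; ℝ⟯, (𝒩 1 ![(f, 0)]).2 = 0 := fun f =>
    (hs (fun _ => -2) ![(f, 0)] (fun a => by fin_cases a; exact mk_zero_mem f)).2 (by simp)
  have hX : ∀ X : Cₛ^∞⟮I; F, E⟯, (𝒩 1 ![(0, X)]).1 = 0 := fun X =>
    (hs (fun _ => -1) ![(0, X)] (fun a => by fin_cases a; exact zero_mk_mem X)).1 (by simp)
  -- $\lambda$ is the value on the constant function $1$; linearity over functions then fixes the
  -- values on all functions.
  refine ⟨{ toFun := fun X => (𝒩 1 ![(0, X)]).2, map_add' := fun X Y => ?_,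
            map_smul' := fun f X => ?_ }, (𝒩 1 ![(1, 0)]).1, ?_⟩
  · rw [← Prod.snd_add, ← hadd, Prod.mk_add_mk, add_zero]
  · rw [RingHom.id_apply, ← Prod.smul_snd, ← hsmul, Prod.smul_mk, smul_zero]
  · refine MultilinearMap.ext fun x => ?_
    have h0 : x = ![(x 0).1 • ((1 : C^∞⟮I, M; ℝ⟯), (0 : Cₛ^∞⟮I; F, E⟯)) + (0, (x 0).2)] := by
      funext a
      rw [Subsingleton.elim a 0]
      ext1 <;> simp
    rw [oneForm_one_apply]
    conv_lhs => rw [h0, hadd, hsmul]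
    ext1
    · simp [hX, mul_comm]
    · simp [hf]

theorem oneForm_injective {N N' : Tensor11 I F E} {lam lam' : C^∞⟮I, M; ℝ⟯}
    (h : oneForm N lam = oneForm N' lam') : N = N' ∧ lam = lam' := by
  have h1 : ∀ w : Total I F E, (lam * w.1, N w.2) = (lam' * w.1, N' w.2) := fun w =>
    congrArg (fun K : KForm (Total I F E) 1 => K ![w]) (congrFun h 1)
  constructor
  · ext1 X
    exact congrArg Prod.snd (h1 (0, X))
  · simpa using congrArg Prod.fst (h1 (1, 0))

theorem isSymmForm_oneForm (N : Tensor11 I F E) (lam : C^∞⟮I, M; ℝ⟯) :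
    IsSymmForm (grading I F E) 0 (oneForm N lam) := by
  intro k
  by_cases hk : k = 1
  · subst hk
    refine ⟨fun d x _ i j hij => by omega, fun d x hx => ?_⟩
    rw [oneForm_one_apply]
    constructor
    · intro h
      rw [(hx 0).1 (by simpa using h), mul_zero]
    · intro h
      rw [(hx 0).2 (by simpa using h), map_zero]
  · rw [oneForm_of_ne_one N lam k hk]
    exact ⟨fun d x _ i j _ => by simp, fun d x _ => by simp⟩

theorem isMultilinearOver_oneForm (N : Tensor11 I F E) (lam : C^∞⟮I, M; ℝ⟯) :
    IsMultilinearOver C^∞⟮I, M; ℝ⟯ (oneForm N lam) := by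
  intro k x i r
  by_cases hk : k = 1
  · subst hk
    obtain rfl : i = 0 := Subsingleton.elim _ _
    rw [oneForm_one_apply, oneForm_one_apply]
    ext1
    · simp [mul_left_comm]
    · simp
  · rw [oneForm_of_ne_one N lam k hk]
    simp

/-- On functions the two multiplications commute, so only the sections give a condition. The minus
sign appears because inserting $N$ into $K$ is the composite $KN$. -/
theorem bracket_oneForm_oneForm (N K : Tensor11 I F E) (lam gam : C^∞⟮I, M; ℝ⟯) :
    RN.bracket (grading I F E) 0 0 (oneForm N lam) (oneForm K gam) = 0 ↔ N ∘ₗ K - K ∘ₗ N = 0 := by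
  have h1 : ∀ (x : Fin 1 → Total I F E) (d : Fin 1 → ℤ), (∀ a, x a ∈ grading I F E (d a)) →
      RN.bracket (grading I F E) 0 0 (oneForm N lam) (oneForm K gam) 1 x =
        (0, -(N ∘ₗ K - K ∘ₗ N) (x 0).2) := by
    intro x d hx
    rw [bracket_one_apply _ _ rfl rfl x d hx]
    simp only [oneForm_one_apply]
    ext1
    · simp [mul_left_comm]
    · simp
  constructor
  · intro h
    ext1 X
    have h2 := h1 ![(0, X)] (fun _ => -1) (fun a => by fin_cases a; exact zero_mk_mem X)
    rw [h] at h2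
    exact neg_eq_zero.1 (congrArg Prod.snd h2).symm
  · intro h
    funext k
    by_cases hk : k = 1
    · subst hk
      refine kform_ext fun d x _ hx => ?_
      rw [h1 x d hx, h]
      simp
    · rw [bracket_zero_apply, insertion_of_arity_one_right _ (oneForm_of_ne_one _ _),
        insertion_of_arity_one_right _ (oneForm_of_ne_one _ _),
        oneForm_of_ne_one _ _ _ hk, oneForm_of_ne_one _ _ _ hk,
        insertOne_zero_form_left, insertOne_zero_form_left, sub_zero]
      rfl

/-- A form of degree `0` which deforms the structure of a pre-Courant algebroid, with an anchor
which is nonzero on a dense set, to the structure of another one, is a `1`-form `N + λ` with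
`N + N^* = λ Id` and `λ` a Casimir function. -/
theorem exists_eq_oneForm_of_bracket_eq {C C' : PreCourant g}
    (hρ : Dense {v : TotalSpace F E | C.anchor.val v.1 v.2 ≠ 0}) {ε : ℤˣ}
    {𝒩 : Form (Total I F E)} (hs : IsSymmForm (grading I F E) 0 𝒩)
    (hm : IsMultilinearOver C^∞⟮I, M; ℝ⟯ 𝒩)
    (h : RN.bracket (grading I F E) 0 1 𝒩 (C.form ε) = C'.form ε) :
    ∃ (N : Tensor11 I F E) (lam : C^∞⟮I, M; ℝ⟯), 𝒩 = oneForm N lam ∧ C.IsCasimir lam ∧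
      ∀ X Y, g.pair (N X) Y + g.pair X (N Y) = lam * g.pair X Y := by
  obtain ⟨N, lam, h𝒩⟩ := exists_oneForm (hs 1).2 hm
  have hN0 : 𝒩 0 = 0 := (hs 0).2.eq_zero_of_ne (by norm_num) (by norm_num)
  have hC0 : C.form ε 0 = 0 := rfl
  let α : Cₛ^∞⟮I; F, E⟯ → Cₛ^∞⟮I; F, E⟯ → C^∞⟮I, M; ℝ⟯ := fun X Y => (𝒩 2 ![(0, X), (0, Y)]).1
  have hmem : ∀ X Y : Cₛ^∞⟮I; F, E⟯, ∀ a, (![(0, X), (0, Y)] : Fin 2 → Total I F E) a ∈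
      grading I F E ((fun _ => -1 : Fin 2 → ℤ) a) := by
    intro X Y a
    fin_cases a
    · exact zero_mk_mem X
    · exact zero_mk_mem Y
  -- Two sections have total degree $-2$, the degree of functions.
  have hα2 : ∀ X Y, 𝒩 2 ![(0, X), (0, Y)] = (α X Y, 0) := fun X Y =>
    Prod.ext rfl (((hs 2).2 _ _ (hmem X Y)).2 (by simp))
  have hα : ∀ (f : C^∞⟮I, M; ℝ⟯) X Y, α X (f • Y) = f * α X Y := by
    intro f X Y
    have h1 := hm 2 ![(0, X), (0, Y)] 1 f
    have h2 : Function.update (![(0, X), (0, Y)] : Fin 2 → Total I F E) 1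
        (f • (![(0, X), (0, Y)] : Fin 2 → Total I F E) 1) = ![(0, X), (0, f • Y)] := by
      funext a
      fin_cases a <;> simp
    rw [h2] at h1
    exact congrArg Prod.fst h1
  have hα' : ∀ X Y, α X Y = -α Y X := by
    intro X Y
    have h1 := (hs 2).1 _ _ (hmem Y X) 0 1 rfl
    have h2 : (fun a => (![(0, Y), (0, X)] : Fin 2 → Total I F E) (Equiv.swap 0 1 a)) =
        ![(0, X), (0, Y)] := by
      funext a
      fin_cases a <;> simp
    have h3 : Int.negOnePow (-1 * -1) = -1 := by simp
    rw [h2, h3, Units.neg_smul, one_smul] at h1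
    exact congrArg Prod.fst h1
  have hb1 : ∀ f, C'.form ε 1 ![(f, 0)] = _ := fun f => by
    rw [← h, bracket_one_apply _ _ hN0 hC0 ![(f, 0)] (fun _ => -2)
      (fun a => by fin_cases a; exact mk_zero_mem f)]
  have hb2 : ∀ (X : Cₛ^∞⟮I; F, E⟯) (f : C^∞⟮I, M; ℝ⟯), C'.form ε 2 ![(0, X), (f, 0)] = _ :=
    fun X f => by
      rw [← h, bracket_two_apply _ _ hN0 hC0 ![(0, X), (f, 0)] ![-1, -2] (fun a => by
        fin_cases a
        · exact zero_mk_mem X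
        · exact mk_zero_mem f)]
  have hb3 : ∀ X Y : Cₛ^∞⟮I; F, E⟯, C'.form ε 2 ![(0, X), (0, Y)] = _ := fun X Y => by
    rw [← h, bracket_two_apply _ _ hN0 hC0 _ _ (hmem X Y)]
  have h1 : ∀ f, D g C'.anchor f = D g C.anchor (lam * f) - N (D g C.anchor f) := by
    intro f
    have := congrArg Prod.snd (hb1 f)
    simpa [h𝒩, PreCourant.form_one_apply, oneForm_one_apply] using this
  -- Both $\mathcal D'$ and $\mathcal D$ kill the constant $1$, so the previous identity at $f=1$
  -- leaves only $\mathcal D\lambda$.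
  have hDl : D g C.anchor lam = 0 := by
    have := h1 1
    simpa [D_one] using this.symm
  have h1' : ∀ f, D g C'.anchor f = lam • D g C.anchor f - N (D g C.anchor f) := by
    intro f
    rw [h1, D_mul, hDl, smul_zero, add_zero]
  have h2 : ∀ X f, defect g N lam X (D g C.anchor f) = 2 * α (D g C.anchor f) X := by
    intro X f
    have h4 := congrArg Prod.fst (hb2 X f)
    -- The total degree is $-3$. The surviving contribution of the $2$-form is $-\alpha(\mathcal
    -- Df,X)$, from inserting $l_1f$.
    have h5 : 𝒩 2 ![(0, X), (f, 0)] = 0 := (hs 2).2.apply_eq_zero (d := ![-1, -2]) (fun a => by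
        fin_cases a
        · exact zero_mk_mem X
        · exact mk_zero_mem f) (by simp) (by simp)
    have h6 : 𝒩 2 ![(0, 0), (f, 0)] = 0 := MultilinearMap.map_coord_zero _ 0 rfl
    have h7 : ¬(2 : ZMod 2) = 1 := by decide
    simp [h5, h6, h7, h𝒩, PreCourant.form_one_apply, oneForm_one_apply,
      PreCourant.form_two_apply, hα2, h1', D_mul, hDl, g.pair_zero_right, g.pair_sub_right,
      g.pair_smul_right] at h4
    rw [two_mul, ← two_smul ℝ (α _ _), defect]
    linear_combination (norm := module) (-2 : ℝ) • h4
  have h3 : ∀ X Y, C'.skew X Y =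
      C.skew (N X) Y + C.skew X (N Y) - N (C.skew X Y) + D g C.anchor (α X Y) := by
    intro X Y
    have h4 := congrArg Prod.snd (hb3 X Y)
    simp [h𝒩, PreCourant.form_one_apply, oneForm_one_apply, PreCourant.form_two_apply, hα2] at h4
    rw [h4, C.skew_swap (N Y) X]
    abel
  have hfin := PreCourant.defect_eq_zero hρ hα hα' h1' h2 h3
  refine ⟨N, lam, ?_, (C.isCasimir_iff lam).2 hDl, fun X Y => sub_eq_zero.1 (hfin X Y).1⟩
  funext k
  by_cases hk1 : k = 1
  · rw [hk1, h𝒩]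
  rw [oneForm_of_ne_one N lam k hk1]
  by_cases hk2 : k = 2
  · subst hk2
    refine (hs 2).2.eq_zero_of_two fun X Y => ?_
    rw [hα2, (hfin X Y).2]
    rfl
  · exact (hs k).2.eq_zero_of_ne hk1 hk2

/-- The transpose can only be $\lambda\,\mathrm{Id}-N$, so the condition becomes an identity on
pairings. -/
theorem exists_isTranspose_iff (N : Tensor11 I F E) (lam : C^∞⟮I, M; ℝ⟯) :
    (∃ N' : Tensor11 I F E, IsTranspose g N N' ∧ N + N' = lam • LinearMap.id) ↔
      ∀ X Y, g.pair (N X) Y + g.pair X (N Y) = lam * g.pair X Y := by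
  constructor
  · rintro ⟨N', h1, h2⟩ X Y
    have h3 : N Y + N' Y = lam • Y := LinearMap.congr_fun h2 Y
    rw [h1, ← g.pair_add_right, add_comm, h3, g.pair_smul_right]
  · intro h
    refine ⟨lam • LinearMap.id - N, fun X Y => ?_, by abel⟩
    rw [LinearMap.sub_apply, g.pair_sub_right]
    change _ = g.pair X (lam • Y) - _
    rw [g.pair_smul_right, ← h X Y]
    abel

theorem bijOn_oneForm (C : PreCourant g)
    (hρ : Dense {v : TotalSpace F E | C.anchor.val v.1 v.2 ≠ 0}) (ε : ℤˣ) :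
    Set.BijOn
      (fun q : Tensor11 I F E × Tensor11 I F E × C^∞⟮I, M; ℝ⟯ × C^∞⟮I, M; ℝ⟯ =>
        (oneForm q.1 q.2.2.1, oneForm q.2.1 q.2.2.2))
      {q | IsNijenhuisQuadruple C q.1 q.2.1 q.2.2.1 q.2.2.2}
      {p | IsNijenhuisPair C ε p.1 p.2} := by
  refine ⟨?_, ?_, ?_⟩
  · rintro ⟨N, K, lam, gam⟩ ⟨hlam, hgam, hdef, hcomm, hN, hK⟩
    rw [exists_isTranspose_iff] at hN hK
    refine ⟨isMultilinearOver_oneForm N lam, isMultilinearOver_oneForm K gam,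
      ⟨isSymmForm_oneForm N lam, isSymmForm_oneForm K gam, ?_,
        (bracket_oneForm_oneForm N K lam gam).2 hcomm⟩, C.deformed N lam hlam hN,
      bracket_oneForm_form C hlam hN ε⟩
    dsimp only
    rw [bracket_oneForm_form C hlam hN,
      bracket_oneForm_form _ (C.deformed_isCasimir hlam hN hlam) hN,
      bracket_oneForm_form C hgam hK]
    exact PreCourant.form_eq_of_bracket_eq
      (LinearMap.ext fun X => LinearMap.ext fun Y => congrFun (congrFun hdef X) Y) ε
  · rintro ⟨N, K, lam, gam⟩ _ ⟨N', K', lam', gam'⟩ _ h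
    obtain ⟨rfl, rfl⟩ := oneForm_injective (congrArg Prod.fst h)
    obtain ⟨rfl, rfl⟩ := oneForm_injective (congrArg Prod.snd h)
    rfl
  · rintro ⟨𝒩, 𝒦⟩ ⟨hm𝒩, hm𝒦, ⟨hs𝒩, hs𝒦, hsq, hcomm⟩, C', hC'⟩
    dsimp only at *
    obtain ⟨N, lam, rfl, hlam, hN⟩ := exists_eq_oneForm_of_bracket_eq hρ hs𝒩 hm𝒩 hC'
    rw [bracket_oneForm_form C hlam hN,
      bracket_oneForm_form _ (C.deformed_isCasimir hlam hN hlam) hN] at hsq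
    -- The equation for the square identifies $[\mathcal K,\mu]$ with the structure of the twice
    -- deformed algebroid. This supplies for $\mathcal K$ the hypothesis that was imposed on
    -- $\mathcal N$ alone.
    obtain ⟨K, gam, rfl, hgam, hK⟩ := exists_eq_oneForm_of_bracket_eq hρ hs𝒦 hm𝒦 hsq.symm
    refine ⟨(N, K, lam, gam), ⟨hlam, hgam, ?_, (bracket_oneForm_oneForm N K lam gam).1 hcomm,
      (exists_isTranspose_iff N lam).2 hN, (exists_isTranspose_iff K gam).2 hK⟩, rfl⟩
    rw [bracket_oneForm_form C hgam hK] at hsq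
    funext X Y
    exact LinearMap.congr_fun₂ (PreCourant.bracket_eq_of_form_eq hsq) X Y

end Components

end Geometry

end Courant

theorem mainTheorem8 {n : ℕ}
    {M : Type*} [TopologicalSpace M] [ChartedSpace (EuclideanSpace ℝ (Fin n)) M]
    [IsManifold (𝓡 n) ∞ M] [T2Space M] [SecondCountableTopology M]
    {F : Type*} [NormedAddCommGroup F] [NormedSpace ℝ F] [FiniteDimensional ℝ F]
    {E : M → Type*} [TopologicalSpace (TotalSpace F E)]
    [∀ x, TopologicalSpace (E x)] [∀ x, AddCommGroup (E x)] [∀ x, Module ℝ (E x)]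
    [∀ x, IsTopologicalAddGroup (E x)] [∀ x, ContinuousSMul ℝ (E x)]
    [FiberBundle F E] [VectorBundle ℝ F E] [ContMDiffVectorBundle ∞ F E (𝓡 n)]
    (g : Courant.InnerProd (𝓡 n) F E) (C : Courant.CourantAlgebroid g)
    (hρ : Dense {v : TotalSpace F E | C.anchor.val v.1 v.2 ≠ 0}) (ε : ℤˣ) :
    Set.BijOn
      (fun q : Courant.Tensor11 (𝓡 n) F E × Courant.Tensor11 (𝓡 n) F E ×
          C^∞⟮𝓡 n, M; ℝ⟯ × C^∞⟮𝓡 n, M; ℝ⟯ =>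
        (Courant.oneForm q.1 q.2.2.1, Courant.oneForm q.2.1 q.2.2.2))
      {q | Courant.IsNijenhuisQuadruple C.toPreCourant q.1 q.2.1 q.2.2.1 q.2.2.2}
      {p | Courant.IsNijenhuisPair C.toPreCourant ε p.1 p.2} := 
  Courant.bijOn_oneForm C.toPreCourant hρ ε
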